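/- Let $n \geq 5$ and let $$H_n = \langle a_i,\ i \in \mathbb{Z}/n\mathbb{Z} \mid a_i a_{i+1} a_i^{-1} = a_{i+1}^2,\ i \in \mathbb{Z}/n\mathbb{Z}\rangle$$ be the generalised Higman group. Let $P$ be the regular right-angled hyperbolic $n$-gon (of curvature $-1$) with cyclically ordered edges $e_i$, $i\in\mathbb{Z}/n\mathbb{Z}$, and for $p \in P$ let $G_p \leq H_n$ be the subgroup generated by the $a_i$ such that $p \in e_i$ (so $G_p$ is trivial in the interior of $P$, is $\langle a_i\rangle$ in the interior of $e_i$, and is $\langle a_i, a_{i+1}\rangle$ at the common vertex of $e_i$ and $e_{i+1}$). Let $X_n$ be the polygonal complex $$X_n = (H_n \times P)/\sim, \qquad (g,p)\sim(g',p') \iff p = p' \text{ and } g^{-1}g' \in G_p,$$ with its length metric (the distance between two points is the infimum of the lengths of the strings of points from one to the other in which consecutive points lie in a common polygon, each step being measured in that polygon), and with the isometric action of $H_n$ by left multiplication on the first factor. 1. If $v$ and $v'$ are vertices of $X_n$ whose combinatorial distance (the graph distance in the $1$-skeleton of $X_n$, every edge having length $1$) is at least $3$, then the stabilisers of $v$ and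 $v'$ in $H_n$ intersect trivially. 2. The action of $H_n$ on $X_n$ is weakly acylindrical: there exist constants $L, N \geq 0$ such that for any two points $x, y$ of $X_n$ at distance at least $L$, at most $N$ elements of $H_n$ fix both $x$ and $y$. -/

import Mathlib

namespace Higman

/-! ### The generalised Higman groups -/

/-- The relators `a_i a_{i+1} a_i⁻¹ (a_{i+1} ^ 2)⁻¹`, `i ∈ ℤ/nℤ`. -/
def rels (n : ℕ) : Set (FreeGroup (ZMod n)) :=
  Set.range fun i : ZMod n =>
    FreeGroup.of i * FreeGroup.of (i + 1) * (FreeGroup.of i)⁻¹ * (FreeGroup.of (i + 1) ^ 2)⁻¹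

/-- The generalised Higman group
`H_n = ⟨a_i, i ∈ ℤ/nℤ | a_i a_{i+1} a_i⁻¹ = a_{i+1} ^ 2, i ∈ ℤ/nℤ⟩`. -/
abbrev HigmanGroup (n : ℕ) : Type := PresentedGroup (rels n)

/-- The generator `a_i` of `H_n`. -/
def gen (n : ℕ) (i : ZMod n) : HigmanGroup n := PresentedGroup.of i

/-! ### The regular right-angled hyperbolic `n`-gon

The hyperbolic plane is taken in its projective (Klein) model, the open unit disc of `ℂ`, in which
geodesics are straight segments and convex hulls are the Euclidean ones. -/

/-- The distance of the hyperbolic plane of curvature `-1` in the Klein model: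
`cosh d(z, w) = (1 - ⟨z, w⟩) / √((1 - |z|²) (1 - |w|²))`. -/
noncomputable def kleinDist (z w : ℂ) : ℝ :=
  Real.arcosh ((1 - inner ℝ z w) / Real.sqrt ((1 - ‖z‖ ^ 2) * (1 - ‖w‖ ^ 2)))

/-- The Euclidean radius, in the Klein model, of the circle through the vertices of the regular
right-angled hyperbolic `n`-gon: the hyperbolic circumradius `R` of that polygon satisfies
`cosh R = cot (π / n)`, and this is `tanh R`. -/
noncomputable def circumradius (n : ℕ) : ℝ :=
  Real.sqrt (1 - Real.tan (Real.pi / n) ^ 2)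

/-- The `k`-th vertex `v_k` of the regular right-angled hyperbolic `n`-gon. -/
noncomputable def corner (n : ℕ) (k : ZMod n) : ℂ :=
  circumradius n * Complex.exp (2 * Real.pi * Complex.I * (k.val / n))

/-- The (solid) regular right-angled hyperbolic `n`-gon. -/
def polygon (n : ℕ) : Set ℂ := convexHull ℝ (Set.range (corner n))

/-- The `i`-th (closed) edge `e_i`, between `v_{i-1}` and `v_i`; thus `v_i` is the common vertex of
`e_i` and `e_{i+1}`. -/
def side (n : ℕ) (i : ZMod n) : Set ℂ := segment ℝ (corner n (i - 1)) (corner n i)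

lemma corner_mem (n : ℕ) (k : ZMod n) : corner n k ∈ polygon n :=
  subset_convexHull ℝ _ (Set.mem_range_self k)

/-- The vertex `v_k` as a point of the polygon. -/
noncomputable def cornerPt (n : ℕ) (k : ZMod n) : polygon n := ⟨corner n k, corner_mem n k⟩

/-! ### The polygonal complex `X_n` -/

/-- The image in `H_n` of the local group of the smallest face of the polygon containing `p`. It is
generated by the `a_i` such that `p` lies on `e_i`: it is `⟨a_i, a_{i+1}⟩` if `p = v_i`,
it is `⟨a_i⟩` if `p` lies in the interior of `e_i`, and it is trivial if `p` is an interior point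
of the polygon. -/
def localGroup (n : ℕ) (p : polygon n) : Subgroup (HigmanGroup n) :=
  Subgroup.closure (gen n '' {i | (p : ℂ) ∈ side n i})

/-- The identifications on `H_n × polygon`:
`(g, p) ∼ (g', p')` if and only if `p = p'` and `g⁻¹ g'` lies in the local group at `p`. -/
def complexSetoid (n : ℕ) : Setoid (HigmanGroup n × polygon n) where
  r x y := x.2 = y.2 ∧ x.1⁻¹ * y.1 ∈ localGroup n x.2
  iseqv :=
    { refl := fun x => ⟨rfl, by simp⟩
      symm := fun {x y} h => ⟨h.1.symm, by
        have := (localGroup n x.2).inv_mem h.2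
        rw [← h.1]
        simpa [mul_inv_rev] using this⟩
      trans := fun {x y z} h k => ⟨h.1.trans k.1, by
        have h2 := k.2
        rw [← h.1] at h2
        have := (localGroup n x.2).mul_mem h.2 h2
        simpa [mul_assoc] using this⟩ }

/-- The polygonal complex `X_n` (as the set of its points): the development of the polygon of groups
with trivial face group, edge groups `⟨a_i⟩` and vertex groups `⟨a_i, a_{i+1}⟩`. -/
def Complex (n : ℕ) : Type := Quotient (complexSetoid n)

/-- The point `[g, p]` of `X_n`, that is, the translate by `g` of the point `p` of the fundamental
polygon. -/
def pt {n : ℕ} (g : HigmanGroup n) (p : polygon n) : Complex n :=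
  Quotient.mk (complexSetoid n) (g, p)

lemma pt_eq_iff {n : ℕ} {g g' : HigmanGroup n} {p p' : polygon n} :
    pt g p = pt g' p' ↔ p = p' ∧ g⁻¹ * g' ∈ localGroup n p :=
  ⟨fun h => Quotient.exact h, fun h => Quotient.sound h⟩

lemma exists_pt {n : ℕ} (x : Complex n) : ∃ g p, x = pt g p := by
  induction x using Quotient.inductionOn with
  | h a => exact ⟨a.1, a.2, rfl⟩

/-- `H_n` acts on `X_n` by `h • [g, p] = [h g, p]`. -/
instance (n : ℕ) : MulAction (HigmanGroup n) (Complex n) where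
  smul h := Quotient.map (fun a => (h * a.1, a.2)) fun a b hab => ⟨hab.1, by
    have := hab.2
    simpa [mul_assoc] using this⟩
  one_smul x := by
    obtain ⟨g, p, rfl⟩ := exists_pt x
    exact congrArg (fun k => pt k p) (one_mul g)
  mul_smul h k x := by
    obtain ⟨g, p, rfl⟩ := exists_pt x
    exact congrArg (fun k => pt k p) (mul_assoc h k g)

lemma smul_pt {n : ℕ} (h g : HigmanGroup n) (p : polygon n) : h • pt g p = pt (h * g) p := rfl

/-- The vertices of `X_n`. -/
def vertexSet (n : ℕ) : Set (Complex n) := {x | ∃ g k, x = pt g (cornerPt n k)}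

/-- The 1-skeleton of `X_n`: two vertices are adjacent if they are the two endpoints of a translate
of some side `e_i` of the fundamental polygon. Its graph metric (every edge has length one) is the
combinatorial distance between vertices of `X_n`. -/
def oneSkeleton (n : ℕ) : SimpleGraph (vertexSet n) :=
  SimpleGraph.fromRel fun v w =>
    ∃ g i, (v : Complex n) = pt g (cornerPt n (i - 1)) ∧ (w : Complex n) = pt g (cornerPt n i)

/-! ### The length metric of `X_n` -/

/-- `IsString x y ℓ` : there is a finite sequence of points from `x` to `y`, any two consecutive ones
being contained in a common polygon `g P` of `X_n`, such that the sum of the distances between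
consecutive points, each measured in such a polygon, is `ℓ`. -/
inductive IsString {n : ℕ} : Complex n → Complex n → ℝ → Prop
  | nil (x : Complex n) : IsString x x 0
  | cons (g : HigmanGroup n) (p q : polygon n) {z : Complex n} {ℓ : ℝ} :
      IsString (pt g q) z ℓ → IsString (pt g p) z (kleinDist p q + ℓ)

/-- The infimum of the lengths of all strings from `x` to `y`. -/
noncomputable def stringDist {n : ℕ} (x y : Complex n) : ℝ := sInf {ℓ | IsString x y ℓ}

/-! The following facts show that, for `n ≥ 5`, this is a metric, for which `H_n` acts by
isometries. -/

lemma kleinDist_comm (z w : ℂ) : kleinDist z w = kleinDist w z := by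
  unfold kleinDist
  rw [real_inner_comm, mul_comm]

lemma klein_arg_ge {z w : ℂ} (hz : ‖z‖ < 1) (hw : ‖w‖ < 1) :
    1 + ‖z - w‖ ^ 2 / 2 ≤ (1 - inner ℝ z w) / Real.sqrt ((1 - ‖z‖ ^ 2) * (1 - ‖w‖ ^ 2)) := by
  have h1 : 0 < 1 - ‖z‖ ^ 2 := by nlinarith [norm_nonneg z]
  have h2 : 0 < 1 - ‖w‖ ^ 2 := by nlinarith [norm_nonneg w]
  have hs : 0 < Real.sqrt ((1 - ‖z‖ ^ 2) * (1 - ‖w‖ ^ 2)) := Real.sqrt_pos.2 (mul_pos h1 h2)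
  have hle : Real.sqrt ((1 - ‖z‖ ^ 2) * (1 - ‖w‖ ^ 2)) ≤ 1 - (‖z‖ ^ 2 + ‖w‖ ^ 2) / 2 := by
    apply Real.sqrt_le_iff.2
    constructor
    · nlinarith
    · nlinarith [sq_nonneg (‖z‖ ^ 2 - ‖w‖ ^ 2)]
  have hd := norm_sub_sq_real z w
  rw [le_div_iff₀ hs]
  calc _ ≤ (1 + ‖z - w‖ ^ 2 / 2) * (1 - (‖z‖ ^ 2 + ‖w‖ ^ 2) / 2) := by
        gcongr
    _ ≤ _ := by
        have : 0 ≤ ‖z - w‖ ^ 2 * (‖z‖ ^ 2 + ‖w‖ ^ 2) := by positivity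
        nlinarith

/-- The hyperbolic distance dominates half of the Euclidean one. -/
lemma norm_sub_le_kleinDist {z w : ℂ} (hz : ‖z‖ < 1) (hw : ‖w‖ < 1) :
    ‖z - w‖ / 2 ≤ kleinDist z w := by
  have h := klein_arg_ge hz hw
  have hle : ‖z - w‖ ≤ 2 := (norm_sub_le z w).trans (by linarith)
  have h0 := norm_nonneg (z - w)
  set t := ‖z - w‖
  set A := (1 - inner ℝ z w) / Real.sqrt ((1 - ‖z‖ ^ 2) * (1 - ‖w‖ ^ 2))
  have hc : Real.cosh (t / 2) ≤ A := by
    refine le_trans ?_ h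
    refine (Real.cosh_le_exp_half_sq _).trans ?_
    have hu : |(t / 2) ^ 2 / 2| ≤ 1 := by
      rw [abs_of_nonneg (by positivity)]; nlinarith
    have := (abs_le.1 (Real.abs_exp_sub_one_le hu)).2
    rw [abs_of_nonneg (by positivity)] at this
    nlinarith
  have h1 : 1 ≤ Real.cosh (t / 2) := Real.one_le_cosh _
  rw [← Real.arcosh_cosh (x := t / 2) (by positivity)]
  exact (Real.arcosh_le_arcosh (by linarith) (by linarith)).2 hc

lemma circumradius_lt_one {n : ℕ} (hn : 5 ≤ n) : circumradius n < 1 := by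
  have hn' : (5 : ℝ) ≤ n := by exact_mod_cast hn
  have hpos : 0 < Real.pi / n := div_pos Real.pi_pos (by linarith)
  have hlt : Real.pi / n < Real.pi / 2 :=
    div_lt_div_of_pos_left Real.pi_pos (by norm_num) (by linarith)
  have ht := Real.tan_pos_of_pos_of_lt_pi_div_two hpos hlt
  unfold circumradius
  rw [Real.sqrt_lt' one_pos]
  nlinarith

lemma norm_corner (n : ℕ) (k : ZMod n) : ‖corner n k‖ = circumradius n := by
  have h : (2 * Real.pi * Complex.I * (k.val / n) : ℂ)
      = ((2 * Real.pi * (k.val / n) : ℝ) : ℂ) * Complex.I := by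
    push_cast; ring
  unfold corner
  rw [h, norm_mul, Complex.norm_exp_ofReal_mul_I, mul_one, Complex.norm_real,
    Real.norm_of_nonneg (show 0 ≤ circumradius n from Real.sqrt_nonneg _)]

lemma norm_lt_one {n : ℕ} (hn : 5 ≤ n) (p : polygon n) : ‖(p : ℂ)‖ < 1 := by
  have h : polygon n ⊆ Metric.closedBall 0 (circumradius n) := by
    refine convexHull_min ?_ (convex_closedBall _ _)
    rintro _ ⟨k, rfl⟩
    simp [norm_corner]
  have := h p.2
  rw [mem_closedBall_zero_iff] at this
  exact this.trans_lt (circumradius_lt_one hn)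

lemma kleinDist_nonneg {n : ℕ} (hn : 5 ≤ n) (p q : polygon n) : 0 ≤ kleinDist p q :=
  le_trans (by positivity) (norm_sub_le_kleinDist (norm_lt_one hn p) (norm_lt_one hn q))

lemma IsString.nonneg {n : ℕ} (hn : 5 ≤ n) {x y : Complex n} {ℓ : ℝ} (h : IsString x y ℓ) :
    0 ≤ ℓ := by
  induction h with
  | nil => exact le_rfl
  | cons g p q _ ih => exact add_nonneg (kleinDist_nonneg hn p q) ih

lemma IsString.trans {n : ℕ} {x y z : Complex n} {ℓ m : ℝ} (h : IsString x y ℓ)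
    (k : IsString y z m) : IsString x z (ℓ + m) := by
  induction h with
  | nil => simpa using k
  | cons g p q _ ih => rw [add_assoc]; exact IsString.cons g p q (ih k)

lemma isString_single {n : ℕ} (g : HigmanGroup n) (p q : polygon n) :
    IsString (pt g p) (pt g q) (kleinDist p q) := by
  simpa using IsString.cons g p q (IsString.nil (pt g q))

lemma IsString.symm {n : ℕ} {x y : Complex n} {ℓ : ℝ} (h : IsString x y ℓ) : IsString y x ℓ := by
  induction h with
  | nil => exact IsString.nil _
  | cons g p q _ ih =>
    rw [add_comm, kleinDist_comm]
    exact ih.trans (isString_single g q p)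

lemma IsString.smul {n : ℕ} (h : HigmanGroup n) {x y : Complex n} {ℓ : ℝ} (s : IsString x y ℓ) :
    IsString (h • x) (h • y) ℓ := by
  induction s with
  | nil => exact IsString.nil _
  | cons g p q _ ih => exact IsString.cons (h * g) p q ih

lemma pt_mul_gen {n : ℕ} (g : HigmanGroup n) (i : ZMod n) :
    pt (g * gen n i) (cornerPt n i) = pt g (cornerPt n i) := by
  refine (pt_eq_iff.2 ⟨rfl, ?_⟩).symm
  rw [inv_mul_cancel_left]
  exact Subgroup.subset_closure ⟨i, right_mem_segment ℝ _ _, rfl⟩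

/-- Any two points of `X_n` are joined by a string. -/
lemma exists_isString {n : ℕ} (x y : Complex n) : ∃ ℓ, IsString x y ℓ := by
  let p0 : polygon n := cornerPt n 0
  let K : Subgroup (HigmanGroup n) :=
    { carrier := {g | ∀ h, ∃ ℓ, IsString (pt h p0) (pt (h * g) p0) ℓ}
      one_mem' := fun h => ⟨0, by simpa using IsString.nil (pt h p0)⟩
      mul_mem' := fun {a b} ha hb h => by
        obtain ⟨l, hl⟩ := ha h
        obtain ⟨m, hm⟩ := hb (h * a)
        exact ⟨l + m, by simpa [mul_assoc] using hl.trans hm⟩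
      inv_mem' := fun {a} ha h => by
        obtain ⟨l, hl⟩ := ha (h * a⁻¹)
        exact ⟨l, by simpa using hl.symm⟩ }
  have hK : ∀ g, g ∈ K := PresentedGroup.generated_by (rels n) K fun i h => by
    have h1 := isString_single h p0 (cornerPt n i)
    have h2 := isString_single (h * gen n i) (cornerPt n i) p0
    rw [pt_mul_gen] at h2
    exact ⟨_, h1.trans h2⟩
  obtain ⟨g, p, rfl⟩ := exists_pt x
  obtain ⟨g', p', rfl⟩ := exists_pt y
  obtain ⟨l, hl⟩ := hK (g⁻¹ * g') g
  rw [mul_inv_cancel_left] at hl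
  exact ⟨_, ((isString_single g p p0).trans hl).trans (isString_single g' p0 p')⟩

lemma stringDist_le {n : ℕ} (hn : 5 ≤ n) {x y : Complex n} {ℓ : ℝ} (h : IsString x y ℓ) :
    stringDist x y ≤ ℓ :=
  csInf_le ⟨0, fun _ hm => IsString.nonneg hn hm⟩ h

lemma exists_isString_lt {n : ℕ} {x y : Complex n} {r : ℝ} (h : stringDist x y < r) :
    ∃ ℓ, IsString x y ℓ ∧ ℓ < r :=
  exists_lt_of_csInf_lt (exists_isString x y) h

lemma stringDist_nonneg {n : ℕ} (hn : 5 ≤ n) (x y : Complex n) : 0 ≤ stringDist x y :=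
  le_csInf (exists_isString x y) fun _ hm => IsString.nonneg hn hm

/-- Near a point `p` of the polygon, only the sides that contain `p` are met. -/
lemma exists_ball_side {n : ℕ} (hn : 5 ≤ n) (p : polygon n) :
    ∃ ε > 0, ∀ q : polygon n, ‖(q : ℂ) - p‖ < ε → localGroup n q ≤ localGroup n p := by
  have : NeZero n := ⟨by omega⟩
  have hclosed : IsClosed (⋃ i ∈ {i : ZMod n | (p : ℂ) ∉ side n i}, side n i) := by
    refine (Set.toFinite _).isClosed_biUnion fun i _ => ?_
    have : side n i = convexHull ℝ {corner n (i - 1), corner n i} := (convexHull_pair _ _).symm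
    rw [this]
    exact ((Set.toFinite _).isCompact_convexHull ℝ).isClosed
  have hp : (p : ℂ) ∈ (⋃ i ∈ {i : ZMod n | (p : ℂ) ∉ side n i}, side n i)ᶜ := by
    simp
  obtain ⟨ε, hε, hball⟩ := Metric.isOpen_iff.1 hclosed.isOpen_compl _ hp
  refine ⟨ε, hε, fun q hq => Subgroup.closure_mono (Set.image_mono fun i hi => ?_)⟩
  by_contra hpi
  exact hball (mem_ball_iff_norm.2 hq) (Set.mem_biUnion (show i ∈ {i | _} from hpi) hi)

lemma string_stays {n : ℕ} (hn : 5 ≤ n) (p : polygon n) {ε : ℝ}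
    (hε : ∀ q : polygon n, ‖(q : ℂ) - p‖ < ε → localGroup n q ≤ localGroup n p)
    {x y : Complex n} {ℓ : ℝ} (h : IsString x y ℓ) :
    ∀ g q, x = pt g q → 2 * ℓ + ‖(q : ℂ) - p‖ < ε → ∀ g' q', y = pt g' q' →
      g⁻¹ * g' ∈ localGroup n p ∧ ‖(q : ℂ) - q'‖ ≤ 2 * ℓ := by
  induction h with
  | nil x =>
    intro g q hx hl g' q' hy
    obtain ⟨rfl, hm⟩ := pt_eq_iff.1 (hx.symm.trans hy)
    exact ⟨hε q (by linarith) hm, by simp⟩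
  | cons g0 p0 q0 hs ih =>
    intro g q hx hl g' q' hy
    obtain ⟨rfl, hm⟩ := pt_eq_iff.1 hx.symm
    have hk := norm_sub_le_kleinDist (norm_lt_one hn q) (norm_lt_one hn q0)
    have htri : ‖(q0 : ℂ) - p‖ ≤ ‖(q : ℂ) - q0‖ + ‖(q : ℂ) - p‖ := by
      rw [norm_sub_rev (q : ℂ) q0]; exact norm_sub_le_norm_sub_add_norm_sub _ _ _
    have hl0 := IsString.nonneg hn hs
    have hk0 := kleinDist_nonneg hn q q0
    obtain ⟨h1, h2⟩ := ih g0 q0 rfl (by linarith) g' q' hy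
    refine ⟨?_, ?_⟩
    · have := (localGroup n p).mul_mem (hε q (by linarith) hm) h1
      simpa [mul_assoc] using this
    · have := norm_sub_le_norm_sub_add_norm_sub (q : ℂ) q0 q'
      linarith

lemma eq_of_stringDist_eq_zero {n : ℕ} (hn : 5 ≤ n) {x y : Complex n} (h : stringDist x y = 0) :
    x = y := by
  obtain ⟨g, p, rfl⟩ := exists_pt x
  obtain ⟨g', p', rfl⟩ := exists_pt y
  obtain ⟨ε, hε, hball⟩ := exists_ball_side hn p
  have key : ∀ δ > 0, δ ≤ ε →
      g⁻¹ * g' ∈ localGroup n p ∧ ‖(p : ℂ) - p'‖ ≤ δ := by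
    intro δ hδ hδε
    obtain ⟨l, hl, hlt⟩ := exists_isString_lt (h.trans_lt (half_pos hδ))
    obtain ⟨h1, h2⟩ := string_stays hn p hball hl g p rfl (by simp; linarith) g' p' rfl
    exact ⟨h1, by linarith⟩
  refine pt_eq_iff.2 ⟨?_, (key ε hε le_rfl).1⟩
  have h0 : ‖(p : ℂ) - p'‖ ≤ 0 := by
    by_contra hc
    push Not at hc
    have hm : 0 < min (‖(p : ℂ) - p'‖ / 2) ε := lt_min (by linarith) hε
    have := (key _ hm (min_le_right _ _)).2
    have := min_le_left (‖(p : ℂ) - p'‖ / 2) ε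
    linarith
  exact Subtype.ext (sub_eq_zero.1 (norm_le_zero_iff.1 h0))

/-- The length metric of the polygonal complex `X_n`, all of whose polygons are regular right-angled
hyperbolic `n`-gons. -/
noncomputable instance (n : ℕ) [hn : Fact (5 ≤ n)] : MetricSpace (Complex n) where
  dist := stringDist
  dist_self x := le_antisymm (stringDist_le hn.out (IsString.nil x)) (stringDist_nonneg hn.out x x)
  dist_comm x y := by
    unfold stringDist
    congr 1
    ext l
    exact ⟨IsString.symm, IsString.symm⟩
  dist_triangle x y z := by
    refine le_of_forall_pos_lt_add fun ε hε => ?_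
    obtain ⟨l, hl, hl'⟩ := exists_isString_lt (lt_add_of_pos_right (stringDist x y) (half_pos hε))
    obtain ⟨m, hm, hm'⟩ := exists_isString_lt (lt_add_of_pos_right (stringDist y z) (half_pos hε))
    have := stringDist_le hn.out (hl.trans hm)
    linarith
  eq_of_dist_eq_zero h := eq_of_stringDist_eq_zero hn.out h

instance (n : ℕ) [Fact (5 ≤ n)] : IsIsometricSMul (HigmanGroup n) (Complex n) where
  isometry_smul h := Isometry.of_dist_eq fun x y => by
    show stringDist _ _ = stringDist _ _
    unfold stringDist
    congr 1
    ext l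
    refine ⟨fun s => ?_, fun s => s.smul h⟩
    have := IsString.smul h⁻¹ s
    simpa using this

end Higman

/-- An isometric action of a group `G` on a metric space `X` is weakly acylindrical if there are
constants `L, N ≥ 0` such that any two points of `X` at distance at least `L` are both fixed by at
most `N` elements of `G`. -/
def WeaklyAcylindrical (G X : Type*) [Group G] [MetricSpace X] [MulAction G X]
    [IsIsometricSMul G X] : Prop :=
  ∃ (L : ℝ) (N : ℕ), 0 ≤ L ∧
    ∀ x y : X, L ≤ dist x y → {g : G | g • x = x ∧ g • y = y}.encard ≤ N

/-! The vertex `[g, v_k]` of the complex is stabilised by `g V_k g⁻¹`, where `V_k = ⟨a_k, a_{k+1}⟩`,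
so both claims concern the intersections of `V_k` with conjugates of `V_l`. By
`classified_higmanGroup`, if `h ≠ 1` lies in `V_k ∩ g V_l g⁻¹`, then `[1, v_k]` and `[g, v_l]`
coincide, are adjacent or have a common neighbour; hence two vertices fixed by `h` are at
combinatorial distance at most two. A point fixed by `h` lies in a polygon with a corner fixed by
`h`, so two fixed points are at most four polygon diameters apart. No curvature argument is needed.

The classification is obtained by building the group from amalgamated products. Baumslag-Solitar
groups are glued successively along infinite cyclic groups `⟨a_i⟩` into chains
(`exists_good_chain`); two chains, from `0` to `2` and from `2` round to `n = 0`, are then glued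
along the free group on `a_0` and `a_2` (`exists_good_univ`). `isAmalgam_pushout` supplies normal
forms, and `Splitting.classified_union` carries the classification from the factors to the product.

The heart is an asymmetry of `⟨s, t | s t s⁻¹ = t ^ 2⟩`: the subgroup `⟨s⟩` is malnormal and no
nontrivial power of `s` is conjugate to a power of `t`, whereas powers of `t` are conjugate to other
powers of `t`. In the Bass-Serre tree, a nontrivial element of a vertex group that fixes an edge is
conjugate to a power of a boundary generator `a_d`. This generator is the first of its chain on one
side (it plays the role of `s`) and the last on the other (the role of `t`). It can fix two edges at
a tree vertex only if that vertex is on the side where `a_d` is last (`Splitting.conj_boundary`).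
The two sides alternate along a path, so no path of three edges is fixed; paths of length zero, one
and two give the cases of `Near`.

For the last gluing, the two ends of a chain must generate a free group whose elliptic elements are
conjugate to powers of the ends. This follows from the parity of alternating products
(`IsAmalgam.exists_conj_eq_zpow`): a cyclically reduced product of even length is not conjugate into
a factor. -/

namespace Higman

/-! ### Alternating products and internal amalgamated products -/

section Alternating

variable {G : Type*} [Group G]

/-- `Alt A F b c g`: the element `g` is a nonempty product of elements taken alternately from
`A true \ F` and `A false \ F`, the first factor from `A b` and the last one from `A c`. -/
inductive Alt (A : Bool → Subgroup G) (F : Subgroup G) : Bool → Bool → G → Prop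
  | single {b : Bool} {x : G} : x ∈ A b → x ∉ F → Alt A F b b x
  | cons {b c : Bool} {x g : G} : x ∈ A b → x ∉ F → Alt A F (!b) c g → Alt A F b c (x * g)

variable {A : Bool → Subgroup G} {F : Subgroup G}

lemma Alt.trans {b c d : Bool} {g k : G} (h : Alt A F b c g) (h' : Alt A F (!c) d k) :
    Alt A F b d (g * k) := by
  induction h with
  | single hx hF => exact Alt.cons hx hF h'
  | cons hx hF _ ih => rw [mul_assoc]; exact Alt.cons hx hF (ih h')

lemma Alt.inv {b c : Bool} {g : G} (h : Alt A F b c g) : Alt A F c b g⁻¹ := by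
  induction h with
  | single hx hF => exact Alt.single (inv_mem hx) (by simpa using hF)
  | @cons b c x g hx hF _ ih =>
    rw [mul_inv_rev]
    exact ih.trans (by simpa using Alt.single (A := A) (inv_mem hx) (by simpa using hF))

lemma Alt.base_mul (hle : ∀ b, F ≤ A b) {b c : Bool} {f g : G} (hf : f ∈ F) (h : Alt A F b c g) :
    Alt A F b c (f * g) := by
  cases h with
  | single hx hF =>
    exact Alt.single (mul_mem (hle _ hf) hx) (by rwa [Subgroup.mul_mem_cancel_left _ hf])
  | cons hx hF h' =>
    rw [← mul_assoc]
    exact Alt.cons (mul_mem (hle _ hf) hx) (by rwa [Subgroup.mul_mem_cancel_left _ hf]) h'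

lemma Alt.mul_base (hle : ∀ b, F ≤ A b) {b c : Bool} {f g : G} (h : Alt A F b c g) (hf : f ∈ F) :
    Alt A F b c (g * f) := by
  simpa using (h.inv.base_mul hle (inv_mem hf)).inv

lemma Alt.map {H : Type*} [Group H] (f : G →* H) {B : Bool → Subgroup H} {E : Subgroup H}
    (hf : ∀ b, ∀ x ∈ A b, x ∉ F → f x ∈ B b ∧ f x ∉ E) {b c : Bool} {g : G}
    (h : Alt A F b c g) : Alt B E b c (f g) := by
  induction h with
  | single hx hF => exact Alt.single (hf _ _ hx hF).1 (hf _ _ hx hF).2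
  | cons hx hF _ ih => rw [map_mul]; exact Alt.cons (hf _ _ hx hF).1 (hf _ _ hx hF).2 ih

/-- The first factor of an alternating product can be split off. -/
lemma Alt.exists_head {c d : Bool} {g : G} (h : Alt A F c d g) (b : Bool) :
    ∃ x ∈ A b, g = x ∨ ∃ m, Alt A F (!b) d m ∧ g = x * m := by
  by_cases hb : c = b
  · subst hb
    cases h with
    | single hx _ => exact ⟨_, hx, Or.inl rfl⟩
    | cons hx _ h' => exact ⟨_, hx, Or.inr ⟨_, h', rfl⟩⟩
  · have : c = !b := by cases b <;> cases c <;> simp_all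
    exact ⟨1, one_mem _, Or.inr ⟨g, this ▸ h, by simp⟩⟩

/-- The last factor of an alternating product can be split off. -/
lemma Alt.exists_last {c d : Bool} {g : G} (h : Alt A F c d g) (b : Bool) :
    ∃ x ∈ A b, g = x ∨ ∃ m, Alt A F c (!b) m ∧ g = m * x := by
  obtain ⟨x, hx, hg | ⟨m, hm, hg⟩⟩ := h.inv.exists_head b
  · exact ⟨x⁻¹, inv_mem hx, Or.inl (by rw [← hg, inv_inv])⟩
  · exact ⟨x⁻¹, inv_mem hx, Or.inr ⟨m⁻¹, hm.inv, by rw [← mul_inv_rev, ← hg, inv_inv]⟩⟩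

/-- Conjugates of elements of a factor outside the amalgamated subgroup, in reduced form. -/
inductive Pal (A : Bool → Subgroup G) (F : Subgroup G) : Bool → G → Prop
  | single {b : Bool} {x : G} : x ∈ A b → x ∉ F → Pal A F b x
  | conj {b : Bool} {y k : G} : y ∈ A b → y ∉ F → Pal A F (!b) k → Pal A F b (y * k * y⁻¹)

lemma Pal.alt {b : Bool} {g : G} (h : Pal A F b g) : Alt A F b b g := by
  induction h with
  | single hx hF => exact Alt.single hx hF
  | conj hy hF _ ih =>
    refine (Alt.cons hy hF ih).trans ?_
    simpa only [Bool.not_not] using Alt.single (inv_mem hy) (by rwa [inv_mem_iff])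

lemma Pal.conj_base (hle : ∀ b, F ≤ A b) {b : Bool} {f g : G} (hf : f ∈ F) (h : Pal A F b g) :
    Pal A F b (f * g * f⁻¹) := by
  cases h with
  | single hx hF =>
    refine Pal.single (mul_mem (mul_mem (hle _ hf) hx) (inv_mem (hle _ hf))) ?_
    rwa [Subgroup.mul_mem_cancel_right _ (inv_mem hf), Subgroup.mul_mem_cancel_left _ hf]
  | @conj _ y k hy hF h' =>
    have : f * (y * k * y⁻¹) * f⁻¹ = (f * y) * k * (f * y)⁻¹ := by group
    rw [this]
    exact Pal.conj (mul_mem (hle _ hf) hy) (by rwa [Subgroup.mul_mem_cancel_left _ hf]) h'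

/-- The reduced conjugates, together with `F`, are stable under conjugation by factor elements: `y`
is either a new outer conjugator, or merges with the present one, and if the merged element falls
into `F` it is absorbed by the layer below. -/
lemma Pal.conj_factor (hle : ∀ b, F ≤ A b) {b : Bool} {y g : G} (hy : y ∈ A b)
    (hg : g ∈ F ∨ ∃ c, Pal A F c g) :
    y * g * y⁻¹ ∈ F ∨ ∃ c, Pal A F c (y * g * y⁻¹) := by
  have hsing : ∀ x ∈ A b, x ∈ F ∨ ∃ c, Pal A F c x := fun x hx => by
    by_cases hF : x ∈ F
    · exact Or.inl hF
    · exact Or.inr ⟨b, Pal.single hx hF⟩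
  rcases hg with hg | ⟨c, hg⟩
  · exact hsing _ (mul_mem (mul_mem hy (hle _ hg)) (inv_mem hy))
  by_cases hyF : y ∈ F
  · exact Or.inr ⟨c, hg.conj_base hle hyF⟩
  by_cases hc : c = b
  · subst hc
    cases hg with
    | single hx hF => exact hsing _ (mul_mem (mul_mem hy hx) (inv_mem hy))
    | @conj _ z k hz hF h' =>
      have : y * (z * k * z⁻¹) * y⁻¹ = (y * z) * k * (y * z)⁻¹ := by group
      rw [this]
      by_cases hyz : y * z ∈ F
      · exact Or.inr ⟨_, h'.conj_base hle hyz⟩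
      · exact Or.inr ⟨_, Pal.conj (mul_mem hy hz) hyz h'⟩
  · have : c = !b := by cases b <;> cases c <;> simp_all
    exact Or.inr ⟨b, Pal.conj hy hyF (this ▸ hg)⟩

/-- In a group generated by two subgroups, every element outside their common subgroup `F` is an
alternating product. -/
lemma mem_or_alt (hle : ∀ b, F ≤ A b) (hsup : A true ⊔ A false = ⊤) (g : G) :
    g ∈ F ∨ ∃ b c, Alt A F b c g := by
  have hg : g ∈ Subgroup.closure ((A true : Set G) ∪ A false) := by
    rw [Subgroup.closure_union, Subgroup.closure_eq, Subgroup.closure_eq, hsup]; trivial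
  have key : ∀ b, ∀ x ∈ A b, ∀ y, (y ∈ F ∨ ∃ b c, Alt A F b c y) →
      (x * y ∈ F ∨ ∃ b c, Alt A F b c (x * y)) := by
    intro b x hx y hy
    by_cases hxF : x ∈ F
    · rcases hy with hy | ⟨c, d, hy⟩
      · exact Or.inl (mul_mem hxF hy)
      · exact Or.inr ⟨c, d, hy.base_mul hle hxF⟩
    rcases hy with hy | ⟨c, d, hy⟩
    · exact Or.inr ⟨b, b, (Alt.single hx hxF).mul_base hle hy⟩
    by_cases hb : c = b
    · subst hb
      cases hy with
      | single hz hzF =>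
        by_cases h : x * y ∈ F
        · exact Or.inl h
        · exact Or.inr ⟨_, _, Alt.single (mul_mem hx hz) h⟩
      | @cons _ _ z m hz hzF h' =>
        rw [← mul_assoc]
        by_cases h : x * z ∈ F
        · exact Or.inr ⟨_, _, h'.base_mul hle h⟩
        · exact Or.inr ⟨_, _, Alt.cons (mul_mem hx hz) h h'⟩
    · have : c = !b := by cases b <;> cases c <;> simp_all
      exact Or.inr ⟨b, d, Alt.cons hx hxF (this ▸ hy)⟩
  induction hg using Subgroup.closure_induction_left with
  | one => exact Or.inl (one_mem _)
  | mul_left x hx y _ ih =>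
    rcases hx with hx | hx
    · exact key _ x hx y ih
    · exact key _ x hx y ih
  | inv_mul_cancel x hx y _ ih =>
    rcases hx with hx | hx
    · exact key true _ (inv_mem hx) y ih
    · exact key false _ (inv_mem hx) y ih

/-- `G` is the amalgamated product of its subgroups `A true` and `A false` along `F`. -/
structure IsAmalgam (A : Bool → Subgroup G) (F : Subgroup G) : Prop where
  le : ∀ b, F ≤ A b
  sup : A true ⊔ A false = ⊤
  alt_notMem : ∀ {b c : Bool} {g : G}, Alt A F b c g → g ∉ F

namespace IsAmalgam

variable (hA : IsAmalgam A F)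
include hA

/-- Otherwise `x * x⁻¹` would be an alternating product of length two equal to `1`. -/
lemma mem_of_mem_of_mem_not {b : Bool} {x : G} (h : x ∈ A b) (h' : x ∈ A (!b)) : x ∈ F := by
  by_contra hF
  refine hA.alt_notMem (Alt.cons h hF (Alt.single (inv_mem h') (by simpa using hF))) ?_
  simp

lemma mem_of_mem_of_mem_ne {b c : Bool} (hbc : b ≠ c) {x : G} (h : x ∈ A b) (h' : x ∈ A c) :
    x ∈ F := by
  have : c = !b := by cases b <;> cases c <;> simp_all
  exact hA.mem_of_mem_of_mem_not h (this ▸ h')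

/-- The parity of the length depends on the element only: two expressions of different parity can be
joined, one of them inverted, into an alternating product equal to `1`. -/
lemma false_of_alt_even_odd {b c : Bool} {g : G} (h : Alt A F b (!b) g) (h' : Alt A F c c g) :
    False := by
  by_cases hb : c = b
  · subst hb
    refine hA.alt_notMem (h.trans (k := g⁻¹) (by simpa using h'.inv)) (by simp)
  · have : b = !c := by cases b <;> cases c <;> simp_all
    subst this
    exact hA.alt_notMem (h'.inv.trans h) (by simp)

/-- If an element of a factor is conjugated into a factor by an alternating product without
cancellation at the ends, then it lies in the amalgamated subgroup. -/
lemma mem_of_conj_mem {b c : Bool} {m h : G} (hm : Alt A F (!b) (!c) m) (hh : h ∈ A b)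
    (hc : m⁻¹ * h * m ∈ A c) : h ∈ F := by
  by_contra hF
  have h1 : Alt A F (!c) (!c) (m⁻¹ * h * m) :=
    (hm.inv.trans (by simpa using Alt.single hh hF)).trans hm
  by_cases h2 : m⁻¹ * h * m ∈ F
  · exact hA.alt_notMem h1 h2
  · have h3 := h1.trans (k := (m⁻¹ * h * m)⁻¹)
      (by simpa only [Bool.not_not] using Alt.single (inv_mem hc) (by rwa [inv_mem_iff]))
    exact hA.alt_notMem h3 (by simp)

/-- The possible ways of conjugating an element of a factor into a factor. In terms of the
Bass-Serre tree: an elliptic element that fixes the vertices of two cosets fixes the path between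
them, of which at most the first three edges are considered. -/
lemma exists_path {b c : Bool} {g h : G} (hh : h ∈ A b) (hc : g⁻¹ * h * g ∈ A c) :
    (b = c ∧ g ∈ A b) ∨
    (b ≠ c ∧ ∃ x ∈ A b, ∃ z ∈ A c, g = x * z ∧ x⁻¹ * h * x ∈ F) ∨
    (b = c ∧ ∃ x ∈ A b, ∃ y ∈ A (!b), y ∉ F ∧ ∃ z ∈ A b, g = x * y * z ∧ x⁻¹ * h * x ∈ F ∧
      y⁻¹ * (x⁻¹ * h * x) * y ∈ F) ∨
    (∃ x ∈ A b, ∃ y ∈ A (!b), y ∉ F ∧ ∃ z ∈ A b, z ∉ F ∧ x⁻¹ * h * x ∈ F ∧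
      y⁻¹ * (x⁻¹ * h * x) * y ∈ F ∧ z⁻¹ * (y⁻¹ * (x⁻¹ * h * x) * y) * z ∈ F) := by
  -- The end factors of `g` that belong to `A b` and `A c` are split off, so that nothing cancels
  -- when the middle part `m` conjugates an element of `A b` into `A c`.
  have hcase : (∃ x ∈ A b, ∃ z ∈ A c, g = x * z) ∨
      ∃ x ∈ A b, ∃ z ∈ A c, ∃ m, Alt A F (!b) (!c) m ∧ g = x * m * z := by
    rcases mem_or_alt hA.le hA.sup g with hg | ⟨b', c', hg⟩
    · exact Or.inl ⟨g, hA.le _ hg, 1, one_mem _, by simp⟩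
    · obtain ⟨x, hx, rfl | ⟨m, hm, rfl⟩⟩ := hg.exists_head b
      · exact Or.inl ⟨_, hx, 1, one_mem _, by simp⟩
      · obtain ⟨z, hz, rfl | ⟨m', hm', rfl⟩⟩ := hm.exists_last c
        · exact Or.inl ⟨x, hx, _, hz, rfl⟩
        · exact Or.inr ⟨x, hx, z, hz, m', hm', by group⟩
  rcases hcase with ⟨x, hx, z, hz, rfl⟩ | ⟨x, hx, z, hz, m, hm, rfl⟩
  · by_cases hbc : b = c
    · subst hbc
      exact Or.inl ⟨rfl, mul_mem hx hz⟩
    · refine Or.inr (Or.inl ⟨hbc, x, hx, z, hz, rfl, hA.mem_of_mem_of_mem_ne hbc ?_ ?_⟩)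
      · exact mul_mem (mul_mem (inv_mem hx) hh) hx
      · have := mul_mem (mul_mem hz hc) (inv_mem hz)
        simpa [mul_assoc] using this
  · have h0 : x⁻¹ * h * x ∈ A b := mul_mem (mul_mem (inv_mem hx) hh) hx
    have h1 : m⁻¹ * (x⁻¹ * h * x) * m ∈ A c := by
      have := mul_mem (mul_mem hz hc) (inv_mem hz)
      simpa [mul_assoc] using this
    have h0F := hA.mem_of_conj_mem hm h0 h1
    have hconj : ∀ {d : Bool} {u v : G}, u ∈ A d → v ∈ F → u⁻¹ * v * u ∈ A d :=
      fun hu hv => mul_mem (mul_mem (inv_mem hu) (hA.le _ hv)) hu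
    -- The indices must be variables for the case analysis on `hm`. Each factor peeled off below is
    -- one more edge of the fixed path.
    generalize hb' : (!b) = b' at hm
    generalize hc' : (!c) = c' at hm
    cases hm with
    | single hy hyF =>
      obtain rfl : b = c := by subst hb'; simpa using hc'.symm
      subst hb'
      exact Or.inr (Or.inr (Or.inl ⟨rfl, x, hx, m, hy, hyF, z, hz, rfl, h0F,
        hA.mem_of_mem_of_mem_not h1 (hconj hy h0F)⟩))
    | @cons _ _ y m' hy hyF hm' =>
      subst hb' hc'
      have h2 : m'⁻¹ * (y⁻¹ * (x⁻¹ * h * x) * y) * m' ∈ A c := by simpa [mul_assoc] using h1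
      have h2F := hA.mem_of_conj_mem hm' (hconj hy h0F) h2
      rw [Bool.not_not] at hm'
      generalize hc' : (!c) = c' at hm'
      refine Or.inr (Or.inr (Or.inr ?_))
      cases hm' with
      | single hz1 hz1F =>
        exact ⟨x, hx, y, hy, hyF, m', hz1, hz1F, h0F, h2F,
          hA.mem_of_mem_of_mem_ne (by cases b <;> cases c <;> simp_all) h2 (hconj hz1 h2F)⟩
      | @cons _ _ z1 m'' hz1 hz1F hm'' =>
        subst hc'
        have h3 : m''⁻¹ * (z1⁻¹ * (y⁻¹ * (x⁻¹ * h * x) * y) * z1) * m'' ∈ A c := by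
          simpa [mul_assoc] using h2
        exact ⟨x, hx, y, hy, hyF, z1, hz1, hz1F, h0F, h2F,
          hA.mem_of_conj_mem hm'' (hconj hz1 h2F) h3⟩

/-- A conjugate of an element of a factor is never an alternating product of even length. -/
lemma not_alt_even_of_conj_mem {b c : Bool} {x h : G} (hh : h ∈ A c) :
    ¬ Alt A F b (!b) (x * h * x⁻¹) := by
  have key : ∀ g, g ∈ F ∨ (∃ b, Pal A F b g) → g ∉ F → ∃ b, Alt A F b b g := fun g hg hF =>
    (hg.resolve_left hF).imp fun _ h => h.alt
  -- Building the conjugator one factor element at a time yields a reduced conjugate, which has odd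
  -- length.
  have hP : x * h * x⁻¹ ∈ F ∨ ∃ b, Pal A F b (x * h * x⁻¹) := by
    have hx : x ∈ Subgroup.closure ((A true : Set G) ∪ A false) := by
      rw [Subgroup.closure_union, Subgroup.closure_eq, Subgroup.closure_eq, hA.sup]; trivial
    induction hx using Subgroup.closure_induction_left with
    | one =>
      by_cases hF : h ∈ F
      · exact Or.inl (by simpa using hF)
      · exact Or.inr ⟨c, by simpa using Pal.single hh hF⟩
    | mul_left y hy x _ ih =>
      have : y * x * h * (y * x)⁻¹ = y * (x * h * x⁻¹) * y⁻¹ := by group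
      rw [this]
      rcases hy with hy | hy
      · exact Pal.conj_factor hA.le hy ih
      · exact Pal.conj_factor hA.le hy ih
    | inv_mul_cancel y hy x _ ih =>
      have : y⁻¹ * x * h * (y⁻¹ * x)⁻¹ = y⁻¹ * (x * h * x⁻¹) * (y⁻¹)⁻¹ := by group
      rw [this]
      rcases hy with hy | hy
      · exact Pal.conj_factor (b := true) hA.le (inv_mem hy) ih
      · exact Pal.conj_factor (b := false) hA.le (inv_mem hy) ih
  intro heven
  obtain ⟨d, hd⟩ := key _ hP (hA.alt_notMem heven)
  exact hA.false_of_alt_even_odd heven hd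

end IsAmalgam

end Alternating

/-- A pushout of injective homomorphisms is an internal amalgamated product. -/
theorem isAmalgam_pushout {G : Bool → Type*} [∀ b, Group (G b)] {H : Type*} [Group H]
    (φ : ∀ b, H →* G b) (hφ : ∀ b, Function.Injective (φ b)) :
    IsAmalgam (fun b => (Monoid.PushoutI.of (φ := φ) b).range) (Monoid.PushoutI.base φ).range where
  le b := by
    rintro _ ⟨x, rfl⟩
    exact ⟨φ b x, Monoid.PushoutI.of_apply_eq_base φ b x⟩
  sup := by
    rw [eq_top_iff]
    intro x _
    induction x using Monoid.PushoutI.induction_on with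
    | of b g => cases b
                · exact Subgroup.mem_sup_right ⟨g, rfl⟩
                · exact Subgroup.mem_sup_left ⟨g, rfl⟩
    | base h =>
      rw [← Monoid.PushoutI.of_apply_eq_base φ true]
      exact Subgroup.mem_sup_left ⟨_, rfl⟩
    | mul x y hx hy => exact mul_mem (hx trivial) (hy trivial)
  alt_notMem := by
    intro b c g h hg
    -- The normal form theorem says that a reduced word with value in the base is empty; recording
    -- the first index both rules this out and lets the induction prepend a letter from the other
    -- factor.
    suffices H : ∃ w : Monoid.CoprodI.Word G, w.fstIdx = some b ∧ Monoid.PushoutI.Reduced φ w ∧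
        Monoid.PushoutI.ofCoprodI w.prod = g by
      obtain ⟨w, hw, hred, rfl⟩ := H
      have := hred.eq_empty_of_mem_range hφ hg
      subst this
      simp [Monoid.CoprodI.Word.fstIdx, Monoid.CoprodI.Word.empty] at hw
    have hred : ∀ {b : Bool} {g : G b}, Monoid.PushoutI.of (φ := φ) b g ∉
        (Monoid.PushoutI.base φ).range → g ∉ (φ b).range := by
      rintro b _ hg ⟨x, rfl⟩
      exact hg ⟨x, (Monoid.PushoutI.of_apply_eq_base φ b x).symm⟩
    clear hg
    induction h with
    | @single b x hx hF =>
      obtain ⟨g, rfl⟩ := hx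
      have h1 : g ≠ 1 := by rintro rfl; exact hF (by simp)
      have h2 : (Monoid.CoprodI.Word.empty : Monoid.CoprodI.Word G).fstIdx ≠ some b := by
        simp [Monoid.CoprodI.Word.fstIdx, Monoid.CoprodI.Word.empty]
      refine ⟨Monoid.CoprodI.Word.cons g .empty h2 h1, Monoid.CoprodI.Word.fstIdx_cons _ _ h2 h1,
        ?_, ?_⟩
      swap
      · rw [Monoid.CoprodI.Word.prod_cons]; simp
      intro l hl
      simp only [Monoid.CoprodI.Word.cons, Monoid.CoprodI.Word.empty, List.mem_singleton] at hl
      subst hl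
      exact hred hF
    | @cons b c x k hx hF _ ih =>
      obtain ⟨g, rfl⟩ := hx
      obtain ⟨w, hw, hr, rfl⟩ := ih
      have h1 : g ≠ 1 := by rintro rfl; exact hF (by simp)
      refine ⟨Monoid.CoprodI.Word.cons g w (by simp [hw]) h1, by simp, ?_, by simp⟩
      intro l hl
      simp only [Monoid.CoprodI.Word.cons, List.mem_cons] at hl
      rcases hl with rfl | hl
      · exact hred hF
      · exact hr l hl

/-! ### Free subgroups of amalgamated products -/

section Free

variable {G : Type*} [Group G]

/-- Alternating products of odd length, built from the inside. -/
inductive OddAlt (A : Bool → Subgroup G) (F : Subgroup G) : Bool → G → Prop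
  | single {b : Bool} {x : G} : x ∈ A b → x ∉ F → OddAlt A F b x
  | step {b : Bool} {x m y : G} : x ∈ A b → x ∉ F → y ∈ A b → y ∉ F → OddAlt A F (!b) m →
      OddAlt A F b (x * m * y)

variable {A : Bool → Subgroup G} {F : Subgroup G}

lemma OddAlt.alt {b : Bool} {g : G} (h : OddAlt A F b g) : Alt A F b b g := by
  induction h with
  | single hx hF => exact Alt.single hx hF
  | step hx hxF hy hyF _ ih =>
    refine (Alt.cons hx hxF ih).trans ?_
    simpa only [Bool.not_not] using Alt.single hy hyF

/-- Prepending two factors shifts the whole nesting: each right-hand factor is paired with a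
left-hand one two places further to the left. -/
lemma OddAlt.cons_cons {b : Bool} {m : G} (h : OddAlt A F b m) : ∀ {x x' : G}, x ∈ A b → x ∉ F →
    x' ∈ A (!b) → x' ∉ F → OddAlt A F b (x * (x' * m)) := by
  induction h with
  | single hy hyF =>
    intro x x' hx hxF hx' hxF'
    rw [← mul_assoc]
    exact OddAlt.step hx hxF hy hyF (OddAlt.single hx' hxF')
  | @step b x1 m y hx1 hx1F hy hyF _ ih =>
    intro x x' hx hxF hx' hxF'
    have : x * (x' * (x1 * m * y)) = x * (x' * (x1 * m)) * y := by group
    rw [this]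
    exact OddAlt.step hx hxF hy hyF (ih hx' hxF' (by rwa [Bool.not_not]) hx1F)

lemma Alt.odd_or_even {b c : Bool} {g : G} (h : Alt A F b c g) :
    (c = b → OddAlt A F b g) ∧
      (c = !b → ∃ x ∈ A b, x ∉ F ∧ ∃ m, OddAlt A F (!b) m ∧ g = x * m) := by
  induction h with
  | single hx hF => exact ⟨fun _ => OddAlt.single hx hF, fun h => by simp at h⟩
  | @cons b c x g hx hF _ ih =>
    refine ⟨fun h => ?_, fun h => ⟨x, hx, hF, g, ih.1 h, rfl⟩⟩
    obtain ⟨x', hx', hF', m, hm, rfl⟩ := ih.2 (by simpa using h)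
    rw [Bool.not_not] at hm
    exact hm.cons_cons hx hF hx' hF'

/-- Cyclic reduction in a free product of two subgroups. -/
lemma exists_cyclically_reduced (hsup : A true ⊔ A false = ⊤) (g : G) :
    ∃ k : G, (∃ b, k⁻¹ * g * k ∈ A b) ∨ ∃ b, Alt A ⊥ b (!b) (k⁻¹ * g * k) := by
  rcases mem_or_alt (F := ⊥) (fun _ => bot_le) hsup g with hg | ⟨b, c, hg⟩
  · rw [Subgroup.mem_bot] at hg
    exact ⟨1, Or.inl ⟨true, by simp [hg, one_mem]⟩⟩
  by_cases hbc : c = b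
  · have hodd := hg.odd_or_even.1 hbc
    clear hg hbc
    induction hodd with
    | @single b x hx _ => exact ⟨1, Or.inl ⟨b, by simpa using hx⟩⟩
    | @step b x m y hx _ hy _ hm ih =>
      -- Conjugation by `x` brings the two outer factors together. Either they cancel and a shorter
      -- odd product remains, or they merge into one factor and the length becomes even.
      by_cases hyx : y * x = 1
      · obtain ⟨k, hk⟩ := ih
        refine ⟨x * k, ?_⟩
        have : (x * k)⁻¹ * (x * m * y) * (x * k) = k⁻¹ * m * (y * x) * k := by group
        rwa [this, hyx, mul_one]
      · refine ⟨x, Or.inr ⟨!b, ?_⟩⟩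
        have : x⁻¹ * (x * m * y) * x = m * (y * x) := by group
        rw [this]
        refine hm.alt.trans ?_
        simpa only [Bool.not_not] using Alt.single (mul_mem hy hx) (by simpa using hyx)
  · have : c = !b := by cases b <;> cases c <;> simp_all
    subst this
    exact ⟨1, Or.inr ⟨b, by simpa using hg⟩⟩

/-! ### Free groups whose generators map to different factors -/

variable {D : Type*} {σ : D → Bool}

/-- The subgroup of a free group generated by the generators labelled `b`. -/
def freeFactor (σ : D → Bool) (b : Bool) : Subgroup (FreeGroup D) :=
  Subgroup.closure (FreeGroup.of '' {d | σ d = b})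

/-- Since the labels are distinct, a factor is cyclic, or trivial if its label does not occur; in
the latter case the generator is arbitrary and the exponent is `0`. -/
lemma freeGroup_factor (hσ : Function.Injective σ) [Nonempty D] {b : Bool} {x : FreeGroup D}
    (hx : x ∈ freeFactor σ b) :
    ∃ d, ∃ p : ℤ, x = FreeGroup.of d ^ p ∧ (x ≠ 1 → σ d = b) := by
  unfold freeFactor at hx
  by_cases h : ∃ d, σ d = b
  · obtain ⟨d, hd⟩ := h
    have : {d | σ d = b} = {d} := by
      ext e
      exact ⟨fun he => hσ (he.trans hd.symm), fun he => by rw [Set.mem_singleton_iff.1 he]; exact hd⟩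
    rw [this, Set.image_singleton, Subgroup.mem_closure_singleton] at hx
    obtain ⟨p, rfl⟩ := hx
    exact ⟨d, p, rfl, fun _ => hd⟩
  · have : {d | σ d = b} = ∅ := by
      ext e; exact ⟨fun he => h ⟨e, he⟩, fun he => he.elim⟩
    rw [this, Set.image_empty, Subgroup.closure_empty, Subgroup.mem_bot] at hx
    exact ⟨Classical.arbitrary D, 0, by simpa using hx, fun h => (h hx).elim⟩

lemma freeGroup_sup (σ : D → Bool) : freeFactor σ true ⊔ freeFactor σ false = ⊤ := by
  unfold freeFactor
  rw [← Subgroup.closure_union, ← Set.image_union, ← FreeGroup.closure_range_of D]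
  congr 1
  ext x
  constructor
  · rintro ⟨d, _, rfl⟩; exact ⟨d, rfl⟩
  · rintro ⟨d, rfl⟩; exact ⟨d, by cases h : σ d <;> simp [h], rfl⟩

/-- A nontrivial element of a factor is a nonzero power of a generator, and its image avoids `F`;
hence reduced forms map to reduced forms. -/
lemma alt_lift (hσ : Function.Injective σ) [Nonempty D] {u : D → G}
    (hu : ∀ d, u d ∈ A (σ d)) (hF : ∀ d, ∀ p : ℤ, u d ^ p ∈ F → p = 0) {b c : Bool}
    {w : FreeGroup D}
    (hw : Alt (freeFactor σ) ⊥ b c w) :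
    Alt A F b c (FreeGroup.lift u w) := by
  refine hw.map _ fun b x hx hx1 => ?_
  obtain ⟨d, p, rfl, hb⟩ := freeGroup_factor hσ hx
  rw [Subgroup.mem_bot] at hx1
  rw [map_zpow, FreeGroup.lift_apply_of]
  refine ⟨hb hx1 ▸ zpow_mem (hu d) p, fun h => hx1 ?_⟩
  rw [hF d p h, zpow_zero]

/-- Elements of different factors which have no power in the amalgamated subgroup generate a free
group. -/
theorem IsAmalgam.lift_injective (hA : IsAmalgam A F) (hσ : Function.Injective σ) [Nonempty D]
    {u : D → G} (hu : ∀ d, u d ∈ A (σ d)) (hF : ∀ d, ∀ p : ℤ, u d ^ p ∈ F → p = 0) :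
    Function.Injective (FreeGroup.lift u) := by
  rw [injective_iff_map_eq_one]
  intro w hw
  rcases mem_or_alt (A := freeFactor σ) (F := ⊥) (fun _ => bot_le) (freeGroup_sup σ) w with
    h | ⟨b, c, h⟩
  · simpa using h
  · refine (hA.alt_notMem (alt_lift hσ hu hF h) (hw ▸ one_mem _)).elim

/-- In the free group generated by elements of different factors which have no power in the
amalgamated subgroup, the elements that are conjugate into a factor are conjugate to powers of the
generators. -/
theorem IsAmalgam.exists_conj_eq_zpow (hA : IsAmalgam A F) (hσ : Function.Injective σ) [Nonempty D]
    {u : D → G} (hu : ∀ d, u d ∈ A (σ d)) (hF : ∀ d, ∀ p : ℤ, u d ^ p ∈ F → p = 0) {f y : G}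
    {b : Bool} (hf : f ∈ (FreeGroup.lift u).range) (hy : y * f * y⁻¹ ∈ A b) :
    ∃ c ∈ (FreeGroup.lift u).range, ∃ d, ∃ p : ℤ, c⁻¹ * f * c = u d ^ p := by
  obtain ⟨w, rfl⟩ := hf
  obtain ⟨k, ⟨b', hk⟩ | ⟨b', hk⟩⟩ := exists_cyclically_reduced
    (A := freeFactor σ) (freeGroup_sup σ) w
  · obtain ⟨d, p, h, -⟩ := freeGroup_factor hσ hk
    refine ⟨FreeGroup.lift u k, ⟨k, rfl⟩, d, p, ?_⟩
    have := congrArg (FreeGroup.lift u) h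
    simpa using this
  · have h1 := alt_lift hσ hu hF hk
    -- A cyclically reduced word of even length has an image of even length, which cannot be
    -- conjugate into a factor.
    refine (hA.not_alt_even_of_conj_mem (b := b') (x := (FreeGroup.lift u k)⁻¹ * y⁻¹) hy ?_).elim
    convert h1 using 1
    simp only [map_mul, map_inv]
    group

end Free

/-! ### The Baumslag-Solitar group `⟨s, t | s t s⁻¹ = t ^ 2⟩` -/

/-- Properties of the standard generators `s`, `t` of the Baumslag-Solitar group of type `(1, 2)`,
as a subgroup of a group. -/
structure BSPair {G : Type*} [Group G] (s t : G) : Prop where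
  zpow_snd : ∀ p : ℤ, t ^ p = 1 → p = 0
  malnormal : ∀ y ∈ Subgroup.closure {s, t}, ∀ p q : ℤ, p ≠ 0 → y * s ^ p * y⁻¹ = s ^ q →
    y ∈ Subgroup.zpowers s
  not_conj : ∀ y ∈ Subgroup.closure {s, t}, ∀ p q : ℤ, y * s ^ p * y⁻¹ = t ^ q → p = 0

lemma BSPair.map {G H : Type*} [Group G] [Group H] {s t : G} (h : BSPair s t) {f : G →* H}
    (hf : Function.Injective f) : BSPair (f s) (f t) := by
  have hcl : Subgroup.closure {f s, f t} = (Subgroup.closure {s, t}).map f := by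
    rw [MonoidHom.map_closure, Set.image_pair]
  constructor
  · intro p hp
    exact h.zpow_snd p (hf (by simpa using hp))
  · rw [hcl]
    rintro _ ⟨y, hy, rfl⟩ p q hp hpq
    have := h.malnormal y hy p q hp (hf (by simpa using hpq))
    rw [← MonoidHom.map_zpowers]
    exact Subgroup.mem_map_of_mem f this
  · rw [hcl]
    rintro _ ⟨y, hy, rfl⟩ p q hpq
    exact h.not_conj y hy p q (hf (by simpa using hpq))

/-- The rules `s t^b = t^(2b) s` and `t^b s⁻¹ = s⁻¹ t^(2b)` move positive powers of `s` to the right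
and negative ones to the left. -/
lemma bs_normal_form {G : Type*} [Group G] {s t : G} (hst : s * t * s⁻¹ = t ^ 2) {y : G}
    (hy : y ∈ Subgroup.closure {s, t}) :
    ∃ (a : ℕ) (b c : ℤ), y = s⁻¹ ^ a * t ^ b * s ^ c := by
  have h1 : ∀ b : ℤ, s * t ^ b = t ^ (2 * b) * s := fun b => by
    have : (s * t * s⁻¹) ^ b = s * t ^ b * s⁻¹ := conj_zpow
    rw [hst, ← zpow_natCast, ← zpow_mul] at this
    rw [show (2 * b : ℤ) = ((2 : ℕ) : ℤ) * b by simp, this]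
    group
  have h2 : ∀ (a : ℕ) (e : ℤ), t ^ e * s⁻¹ ^ a = s⁻¹ ^ a * t ^ (2 ^ a * e) := by
    intro a
    induction a with
    | zero => simp
    | succ a ih =>
      intro e
      have h3 : t ^ e * s⁻¹ = s⁻¹ * t ^ (2 * e) := by
        rw [eq_inv_mul_iff_mul_eq, ← mul_assoc, h1]
        group
      rw [pow_succ', ← mul_assoc, h3, mul_assoc, ih, ← mul_assoc, ← mul_assoc, ← pow_succ']
      congr 2
  have hs : ∀ z, (∃ (a : ℕ) (b c : ℤ), z = s⁻¹ ^ a * t ^ b * s ^ c) →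
      ∃ (a : ℕ) (b c : ℤ), s * z = s⁻¹ ^ a * t ^ b * s ^ c := by
    rintro _ ⟨a, b, c, rfl⟩
    cases a with
    | zero =>
      refine ⟨0, 2 * b, c + 1, ?_⟩
      rw [pow_zero, one_mul, one_mul, ← mul_assoc, h1, mul_assoc, add_comm, zpow_one_add]
    | succ a => exact ⟨a, b, c, by rw [pow_succ']; group⟩
  have ht : ∀ (e : ℤ) z, (∃ (a : ℕ) (b c : ℤ), z = s⁻¹ ^ a * t ^ b * s ^ c) →
      ∃ (a : ℕ) (b c : ℤ), t ^ e * z = s⁻¹ ^ a * t ^ b * s ^ c := by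
    rintro e _ ⟨a, b, c, rfl⟩
    refine ⟨a, 2 ^ a * e + b, c, ?_⟩
    rw [← mul_assoc, ← mul_assoc, h2, zpow_add]
    group
  induction hy using Subgroup.closure_induction_left with
  | one => exact ⟨0, 0, 0, by simp⟩
  | mul_left x hx y _ ih =>
    rcases hx with rfl | rfl
    · exact hs y ih
    · simpa using ht 1 y ih
  | inv_mul_cancel x hx y _ ih =>
    rcases hx with rfl | rfl
    · obtain ⟨a, b, c, rfl⟩ := ih
      exact ⟨a + 1, b, c, by rw [pow_succ']; group⟩
    · simpa using ht (-1) y ih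

/-- The relation of the Baumslag-Solitar group and a homomorphism to the affine group of `ℚ` that
is injective on the subgroup generated by `t` imply the properties of `BSPair`. -/
lemma bsPair_of_affine {G : Type*} [Group G] {s t : G} (hst : s * t * s⁻¹ = t ^ 2)
    (ρ : G →* Equiv.Perm ℚ) (hs : ρ s = Equiv.mulLeft₀ 2 two_ne_zero)
    (ht : ρ t = Equiv.addRight 1) : BSPair s t := by
  have hsp : ∀ (p : ℤ) x, ρ (s ^ p) x = 2 ^ p * x := by
    have hnat : ∀ (p : ℕ) x, ρ (s ^ p) x = 2 ^ p * x := by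
      intro p
      induction p with
      | zero => simp
      | succ p ih => intro x; rw [pow_succ, map_mul, Equiv.Perm.mul_apply, ih, hs]; simp; ring
    intro p x
    obtain ⟨k, rfl | rfl⟩ := p.eq_nat_or_neg
    · simpa using hnat k x
    · rw [zpow_neg, map_inv, Equiv.Perm.inv_eq_iff_eq, zpow_natCast, hnat]
      rw [zpow_neg, zpow_natCast]
      field_simp
  have htp : ∀ (p : ℤ) x, ρ (t ^ p) x = x + p := by
    have hnat : ∀ (p : ℕ) x, ρ (t ^ p) x = x + p := by
      intro p
      induction p with
      | zero => simp
      | succ p ih => intro x; rw [pow_succ, map_mul, Equiv.Perm.mul_apply, ih, ht]; simp; ring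
    intro p x
    obtain ⟨k, rfl | rfl⟩ := p.eq_nat_or_neg
    · simpa using hnat k x
    · rw [zpow_neg, map_inv, Equiv.Perm.inv_eq_iff_eq, zpow_natCast, hnat]
      push_cast
      ring
  have hone : ∀ p : ℤ, s ^ p = 1 → p = 0 := fun p hp => by
    have := hsp p 1
    rw [hp, mul_one, map_one ρ, Equiv.Perm.one_apply] at this
    exact (zpow_eq_one_iff_right₀ (by norm_num) (by norm_num)).1 this.symm
  -- Under `ρ`, `s` is `x ↦ 2x` and `t` is `x ↦ x + 1`. Conjugates of powers of `s` thus have a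
  -- fixed point, whereas a nonzero power of `t` has none.
  have hfix : ∀ (y : G) (p : ℤ), ρ (y * s ^ p * y⁻¹) (ρ y 0) = ρ y 0 := fun y p => by
    have : y * s ^ p * y⁻¹ * y = y * s ^ p := by group
    rw [← Equiv.Perm.mul_apply, ← map_mul, this, map_mul, Equiv.Perm.mul_apply, hsp, mul_zero]
  refine ⟨fun p hp => ?_, fun y hy p q hp h => ?_, fun y _ p q h => ?_⟩
  · have := htp p 0
    rw [hp, map_one, Equiv.Perm.one_apply] at this
    simpa using this.symm
  · have h1 := hfix y p
    rw [h, hsp] at h1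
    -- If `y` fixes `0`, its normal form has no `t`-part. Otherwise `s ^ q` fixes a nonzero
    -- rational, which forces `q = 0`.
    by_cases hz : ρ y 0 = 0
    · obtain ⟨a, b, c, rfl⟩ := bs_normal_form hst hy
      have h2 : s⁻¹ ^ a = s ^ (-a : ℤ) := by simp
      rw [h2] at hz ⊢
      rw [map_mul, map_mul, Equiv.Perm.mul_apply, Equiv.Perm.mul_apply, hsp, hsp, htp] at hz
      have hb : b = 0 := by
        have : (2 : ℚ) ^ (-a : ℤ) ≠ 0 := zpow_ne_zero _ two_ne_zero
        simpa [this] using hz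
      rw [hb, zpow_zero, mul_one]
      exact mul_mem (zpow_mem (Subgroup.mem_zpowers s) _) (zpow_mem (Subgroup.mem_zpowers s) _)
    · have hq : (2 : ℚ) ^ q = 1 := mul_right_cancel₀ hz (by rw [h1, one_mul])
      have hq0 : q = 0 := (zpow_eq_one_iff_right₀ (by norm_num) (by norm_num)).1 hq
      rw [hq0, zpow_zero, mul_inv_eq_one, mul_eq_left] at h
      exact (hp (hone p h)).elim
  · have h1 := hfix y p
    rw [h, htp] at h1
    have hq : q = 0 := by simpa using h1
    rw [hq, zpow_zero, mul_inv_eq_one, mul_eq_left] at h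
    exact hone p h

/-- The Baumslag-Solitar group of type `(1, 2)`, with its universal property. -/
theorem exists_bs : ∃ (G : Type) (_ : Group G) (s t : G), s * t * s⁻¹ = t ^ 2 ∧
    Subgroup.closure {s, t} = ⊤ ∧ BSPair s t ∧
    ∀ (K : Type) [Group K] (x y : K), x * y * x⁻¹ = y ^ 2 → ∃ φ : G →* K, φ s = x ∧ φ t = y := by
  let r : FreeGroup Bool := FreeGroup.of true * FreeGroup.of false * (FreeGroup.of true)⁻¹ *
    (FreeGroup.of false ^ 2)⁻¹
  let a : Bool → PresentedGroup {r} := PresentedGroup.of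
  have huniv : ∀ (K : Type) [Group K] (x y : K), x * y * x⁻¹ = y ^ 2 →
      ∃ φ : PresentedGroup {r} →* K, φ (a true) = x ∧ φ (a false) = y := by
    intro K _ x y hxy
    have hr : ∀ q ∈ ({r} : Set (FreeGroup Bool)),
        FreeGroup.lift (fun b : Bool => if b then x else y) q = 1 := by
      rintro _ rfl
      simp [r, hxy]
    refine ⟨PresentedGroup.toGroup hr, ?_, ?_⟩
    · exact (PresentedGroup.toGroup.of hr).trans (by simp)
    · exact (PresentedGroup.toGroup.of hr).trans (by simp)
  have hrel : a true * a false * (a true)⁻¹ = a false ^ 2 := by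
    have : PresentedGroup.mk {r} r = 1 := PresentedGroup.one_of_mem rfl
    exact mul_inv_eq_one.1 this
  have hgen : Subgroup.closure {a true, a false} = ⊤ := by
    rw [← PresentedGroup.closure_range_of {r}]
    congr 1
    ext x
    simp [a, or_comm]
  refine ⟨_, inferInstance, a true, a false, hrel, hgen, ?_, huniv⟩
  obtain ⟨ρ, h1, h2⟩ := huniv (Equiv.Perm ℚ) (Equiv.mulLeft₀ 2 two_ne_zero) (Equiv.addRight 1) (by
    ext x
    simp [Equiv.Perm.mul_apply, pow_two, mul_add, Equiv.Perm.inv_def]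
    ring)
  exact bsPair_of_affine hrel ρ h1 h2

/-! ### Intersections of vertex groups -/

section Classification

variable {n : ℕ} {G : Type*} [Group G]

/-- The subgroup generated by `a k` and `a (k + 1)`. -/
def vgrp (a : ZMod n → G) (k : ZMod n) : Subgroup G := Subgroup.closure {a k, a (k + 1)}

lemma fst_mem_vgrp (a : ZMod n → G) (k : ZMod n) : a k ∈ vgrp a k :=
  Subgroup.subset_closure (by simp)

lemma snd_mem_vgrp (a : ZMod n → G) (k : ZMod n) : a (k + 1) ∈ vgrp a k :=
  Subgroup.subset_closure (by simp)

lemma mem_vgrp_sub_one (a : ZMod n → G) (k : ZMod n) : a k ∈ vgrp a (k - 1) := by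
  simpa using snd_mem_vgrp a (k - 1)

/-- The configurations of an element `h` of the `k`-th vertex group whose conjugate by `g` lies in
the `l`-th one: the corresponding vertices of the complex are equal, adjacent, or have a common
neighbour of a special kind. -/
def Near (S : Set (ZMod n)) (a : ZMod n → G) (k l : ZMod n) (h g : G) : Prop :=
  (l = k ∧ g ∈ vgrp a k) ∨
  (l = k + 1 ∧ ∃ u ∈ vgrp a k, ∃ v ∈ vgrp a l, g = u * v ∧ u⁻¹ * h * u ∈ Subgroup.zpowers (a l)) ∨
  (k = l + 1 ∧ ∃ u ∈ vgrp a k, ∃ v ∈ vgrp a l, g = u * v ∧ u⁻¹ * h * u ∈ Subgroup.zpowers (a k)) ∨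
  (l = k ∧ ∃ j ∈ S, j + 1 = k ∧ ∃ u ∈ vgrp a k, ∃ v ∈ vgrp a j, ∃ w ∈ vgrp a k, g = u * v * w ∧
    u⁻¹ * h * u ∈ Subgroup.zpowers (a k))

lemma Near.mono {S T : Set (ZMod n)} (hST : S ⊆ T) {a : ZMod n → G} {k l : ZMod n} {h g : G}
    (H : Near S a k l h g) : Near T a k l h g := by
  rcases H with H | H | H | ⟨h1, j, hj, H⟩
  · exact Or.inl H
  · exact Or.inr (Or.inl H)
  · exact Or.inr (Or.inr (Or.inl H))
  · exact Or.inr (Or.inr (Or.inr ⟨h1, j, hST hj, H⟩))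

/-- The classification of the intersections of conjugates (by elements of `A`) of vertex groups. -/
def Classified (A : Subgroup G) (S : Set (ZMod n)) (a : ZMod n → G) : Prop :=
  ∀ k ∈ S, ∀ l ∈ S, ∀ h ∈ vgrp a k, h ≠ 1 → ∀ g ∈ A, g⁻¹ * h * g ∈ vgrp a l → Near S a k l h g

variable {A : Subgroup G} {S : Set (ZMod n)} {a : ZMod n → G}

lemma BSPair.zpow_fst {s t : G} (h : BSPair s t) {p : ℤ} (hp : s ^ p = 1) : p = 0 :=
  h.not_conj 1 (one_mem _) p 0 (by simpa using hp)

/-- The powers of the first generator of a chain lie in a single vertex group. -/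
lemma Classified.of_first (hcls : Classified A S a) (hbs : ∀ k ∈ S, BSPair (a k) (a (k + 1)))
    {d k : ZMod n} (hd : d ∈ S) (hd' : d - 1 ∉ S) {y : G} (hy : y ∈ A) {p : ℤ} (hp : p ≠ 0)
    (hk : k ∈ S) (h : y * a d ^ p * y⁻¹ ∈ vgrp a k) : k = d ∧ y ∈ vgrp a d := by
  have hne : a d ^ p ≠ 1 := fun h => hp ((hbs d hd).zpow_fst h)
  rcases hcls d hd k hk _ (zpow_mem (fst_mem_vgrp a d) p) hne y⁻¹ (inv_mem hy)
    (by simpa using h) with ⟨h1, h2⟩ | ⟨h1, u, hu, v, _, _, h2⟩ | ⟨h1, _⟩ | ⟨_, j, hj, h1, _⟩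
  · exact ⟨h1, by simpa using h2⟩
  · obtain ⟨q, hq⟩ := Subgroup.mem_zpowers_iff.1 h2
    subst h1
    exact (hp ((hbs d hd).not_conj u⁻¹ (inv_mem hu) p q (by rw [hq, inv_inv]))).elim
  · exact (hd' (by rw [h1]; simpa using hk)).elim
  · exact (hd' (by rw [← h1]; simpa using hj)).elim

/-- The powers of the last generator of a chain lie in a single vertex group. -/
lemma Classified.of_last (hcls : Classified A S a) (hbs : ∀ k ∈ S, BSPair (a k) (a (k + 1)))
    {e k : ZMod n} (he : e ∈ S) (he' : e + 1 ∉ S) {y : G} (hy : y ∈ A) {p : ℤ} (hp : p ≠ 0)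
    (hk : k ∈ S) (h : y * a (e + 1) ^ p * y⁻¹ ∈ vgrp a k) : k = e ∧ y ∈ vgrp a e := by
  have hne : a (e + 1) ^ p ≠ 1 := fun h => hp ((hbs e he).zpow_snd p h)
  have key : ∀ u ∈ vgrp a e, u⁻¹ * a (e + 1) ^ p * u ∉ Subgroup.zpowers (a e) := by
    intro u hu h2
    obtain ⟨q, hq⟩ := Subgroup.mem_zpowers_iff.1 h2
    have hq0 : q = 0 := (hbs e he).not_conj u hu q p (by rw [hq]; group)
    rw [hq0, zpow_zero] at hq
    apply hne
    have : a (e + 1) ^ p = u * (u⁻¹ * a (e + 1) ^ p * u) * u⁻¹ := by group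
    rw [this, ← hq]
    group
  rcases hcls e he k hk _ (zpow_mem (snd_mem_vgrp a e) p) hne y⁻¹ (inv_mem hy)
    (by simpa using h) with ⟨h1, h2⟩ | ⟨h1, _⟩ | ⟨_, u, hu, v, _, _, h2⟩ |
      ⟨_, _, _, _, u, hu, v, _, _, _, _, h2⟩
  · exact ⟨h1, by simpa using h2⟩
  · exact (he' (h1 ▸ hk)).elim
  · exact (key u hu h2).elim
  · exact (key u hu h2).elim

/-- An amalgamated product of two groups whose vertex groups are classified, along a subgroup `F`
generated by end generators of both factors. -/
structure Splitting (A : Bool → Subgroup G) (F : Subgroup G) (S : Bool → Set (ZMod n))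
    (D : Set (ZMod n)) (a : ZMod n → G) : Prop where
  amalgam : IsAmalgam A F
  vgrp_le : ∀ b, ∀ k ∈ S b, vgrp a k ≤ A b
  bs : ∀ b, ∀ k ∈ S b, BSPair (a k) (a (k + 1))
  classified : ∀ b, Classified (A b) (S b) a
  boundary : ∀ d ∈ D, ∃ b, d ∈ S b ∧ d - 1 ∉ S b ∧ d - 1 ∈ S (!b) ∧ d ∉ S (!b)
  mem_base : ∀ d ∈ D, a d ∈ F
  elliptic : ∀ b, ∀ f ∈ F, ∀ y ∈ A b, ∀ k ∈ S b, y * f * y⁻¹ ∈ vgrp a k →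
    ∃ c ∈ F, ∃ d ∈ D, ∃ p : ℤ, c⁻¹ * f * c = a d ^ p

/-! ### From the factors to the amalgamated product -/

namespace Splitting

variable {A : Bool → Subgroup G} {F : Subgroup G} {S : Bool → Set (ZMod n)} {D : Set (ZMod n)}
  {a : ZMod n → G} (H : Splitting A F S D a)
include H

lemma boundary_cases (b : Bool) {d : ZMod n} (hd : d ∈ D) :
    (d ∈ S b ∧ d - 1 ∉ S b ∧ d - 1 ∈ S (!b) ∧ d ∉ S (!b)) ∨
    (d ∈ S (!b) ∧ d - 1 ∉ S (!b) ∧ d - 1 ∈ S b ∧ d ∉ S b) := by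
  obtain ⟨c, hc⟩ := H.boundary d hd
  by_cases hb : c = b
  · subst hb; exact Or.inl hc
  · have : c = !b := by cases b <;> cases c <;> simp_all
    subst this
    exact Or.inr (by simpa using hc)

lemma zpow_ne_one {d : ZMod n} (hd : d ∈ D) {p : ℤ} (hp : p ≠ 0) : a d ^ p ≠ 1 := by
  obtain ⟨b, hb, -⟩ := H.boundary d hd
  exact fun h => hp ((H.bs b d hb).zpow_fst h)

lemma exists_vertex (b : Bool) {d : ZMod n} (hd : d ∈ D) : ∃ k ∈ S b, a d ∈ vgrp a k := by
  rcases H.boundary_cases b hd with ⟨h, -⟩ | ⟨-, -, h, -⟩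
  · exact ⟨d, h, fst_mem_vgrp a d⟩
  · exact ⟨d - 1, h, mem_vgrp_sub_one a d⟩

lemma first {b : Bool} {d k : ZMod n} (hd : d ∈ S b) (hd' : d - 1 ∉ S b) {y : G} (hy : y ∈ A b)
    {p : ℤ} (hp : p ≠ 0) (hk : k ∈ S b) (h : y * a d ^ p * y⁻¹ ∈ vgrp a k) :
    k = d ∧ y ∈ vgrp a d :=
  (H.classified b).of_first (H.bs b) hd hd' hy hp hk h

lemma last {b : Bool} {d k : ZMod n} (hd : d - 1 ∈ S b) (hd' : d ∉ S b) {y : G} (hy : y ∈ A b)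
    {p : ℤ} (hp : p ≠ 0) (hk : k ∈ S b) (h : y * a d ^ p * y⁻¹ ∈ vgrp a k) :
    k = d - 1 ∧ y ∈ vgrp a (d - 1) :=
  (H.classified b).of_last (H.bs b) hd (by simpa using hd') hy hp hk (by simpa using h)

/-- The powers of a boundary generator are conjugate into the amalgamated subgroup by an element
outside it only on the side where the generator is the last one. -/
lemma conj_boundary {b : Bool} {d : ZMod n} (hd : d ∈ D) {p : ℤ} (hp : p ≠ 0) {y : G}
    (hy : y ∈ A b) (hyF : y ∉ F) (h : y⁻¹ * a d ^ p * y ∈ F) :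
    d - 1 ∈ S b ∧ d ∉ S b ∧ ∃ c ∈ F, ∃ q : ℤ, q ≠ 0 ∧ y * c ∈ vgrp a (d - 1) ∧
      (y * c)⁻¹ * a d ^ p * (y * c) = a d ^ q := by
  obtain ⟨k, hk, hdk⟩ := H.exists_vertex b hd
  obtain ⟨c, hc, d', hd'D, q, hq⟩ := H.elliptic b _ h y hy k hk (by
    have : y * (y⁻¹ * a d ^ p * y) * y⁻¹ = a d ^ p := by group
    rw [this]; exact zpow_mem hdk p)
  have hw : (y * c)⁻¹ * a d ^ p * (y * c) = a d' ^ q := by rw [← hq]; group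
  have hwA : y * c ∈ A b := mul_mem hy (H.amalgam.le b hc)
  have hwF : y * c ∉ F := by rwa [Subgroup.mul_mem_cancel_right _ hc]
  have hq0 : q ≠ 0 := by
    rintro rfl
    apply H.zpow_ne_one hd hp
    have : a d ^ p = (y * c) * ((y * c)⁻¹ * a d ^ p * (y * c)) * (y * c)⁻¹ := by group
    rw [this, hw]
    group
  obtain ⟨k', hk', hdk'⟩ := H.exists_vertex b hd'D
  have hmem : ∀ k', a d' ∈ vgrp a k' → (y * c)⁻¹ * a d ^ p * (y * c)⁻¹⁻¹ ∈ vgrp a k' :=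
    fun k' hk' => by rw [inv_inv, hw]; exact zpow_mem hk' q
  -- If `a d` is first on side `b`, either `d' = d` and malnormality forces `y * c` into `F`, or `d'
  -- = d + 1` and powers of the two generators of one vertex group would be conjugate. If it is
  -- last, the same obstruction excludes a first generator `d'`, leaving `d' = d`.
  rcases H.boundary_cases b hd with ⟨h1, h2, -, -⟩ | ⟨-, -, h1, h2⟩
  · exfalso
    rcases H.boundary_cases b hd'D with ⟨h3, -, -, -⟩ | ⟨-, -, h3, -⟩
    · obtain ⟨rfl, h5⟩ := H.first h1 h2 (inv_mem hwA) hp h3 (hmem _ (fst_mem_vgrp a d'))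
      have := (H.bs b d' h1).malnormal (y * c)⁻¹ h5 p q hp (by rw [inv_inv, hw])
      refine hwF ?_
      rw [← inv_mem_iff]
      exact Subgroup.zpowers_le.2 (H.mem_base d' hd) this
    · obtain ⟨h4, h5⟩ := H.first h1 h2 (inv_mem hwA) hp h3 (hmem _ (mem_vgrp_sub_one a d'))
      refine hp ((H.bs b d h1).not_conj (y * c)⁻¹ h5 p q ?_)
      rw [inv_inv, hw, ← h4]
      simp
  · rcases H.boundary_cases b hd'D with ⟨h3, h3', -, -⟩ | ⟨-, -, h3, -⟩
    · exfalso
      obtain ⟨h4, h5⟩ := H.last h1 h2 (inv_mem hwA) hp h3 (hmem _ (fst_mem_vgrp a d'))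
      refine hq0 ((H.bs b (d - 1) h1).not_conj (y * c) (inv_mem_iff.1 h5) q p ?_)
      rw [← h4, ← hw, h4]
      simp only [sub_add_cancel]
      group
    · obtain ⟨h4, h5⟩ := H.last h1 h2 (inv_mem hwA) hp h3 (hmem _ (mem_vgrp_sub_one a d'))
      have h6 : d' = d := sub_left_injective h4
      subst h6
      exact ⟨h1, h2, c, hc, q, hq0, by simpa using inv_mem h5, hw⟩

/-- The path in the Bass-Serre tree fixed by `h` has at most two edges. Its length, and the side on
which the boundary generator is first, determine which alternative of `Near` occurs. -/
theorem classified_union : Classified ⊤ (S true ∪ S false) a := by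
  have hsub : ∀ b, S b ⊆ S true ∪ S false := fun b => by
    cases b
    · exact Set.subset_union_right
    · exact Set.subset_union_left
  suffices key : ∀ b c, ∀ k ∈ S b, ∀ l ∈ S c, ∀ h ∈ vgrp a k, h ≠ 1 → ∀ g : G,
      g⁻¹ * h * g ∈ vgrp a l → Near (S true ∪ S false) a k l h g by
    have hmem : ∀ k ∈ S true ∪ S false, ∃ b, k ∈ S b := fun k hk => hk.elim (⟨_, ·⟩) (⟨_, ·⟩)
    intro k hk l hl h hh h1 g _ hg
    obtain ⟨b, hb⟩ := hmem k hk
    obtain ⟨c, hc⟩ := hmem l hl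
    exact key b c k hb l hc h hh h1 g hg
  intro b c k hk l hl h hh h1 g hg
  -- As `h` is in a vertex group, its conjugate in `F` is elliptic, so it can be adjusted by some `c
  -- ∈ F` to a power of a boundary generator, nontrivial because `h ≠ 1`.
  have hell : ∀ x ∈ A b, x⁻¹ * h * x ∈ F → ∃ c ∈ F, ∃ d ∈ D, ∃ p : ℤ, p ≠ 0 ∧
      (x * c)⁻¹ * h * (x * c) = a d ^ p ∧ x * c ∈ A b ∧
      (x * c) * a d ^ p * (x * c)⁻¹ ∈ vgrp a k := by
    intro x hx hxF
    obtain ⟨c, hc, d, hd, p, hp⟩ := H.elliptic b _ hxF x hx k hk (by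
      have : x * (x⁻¹ * h * x) * x⁻¹ = h := by group
      rwa [this])
    have hp' : (x * c)⁻¹ * h * (x * c) = a d ^ p := by rw [← hp]; group
    have hh' : (x * c) * a d ^ p * (x * c)⁻¹ = h := by rw [← hp']; group
    refine ⟨c, hc, d, hd, p, ?_, hp', mul_mem hx (H.amalgam.le b hc), hh' ▸ hh⟩
    rintro rfl
    apply h1
    rw [← hh']
    group
  rcases H.amalgam.exists_path (H.vgrp_le b k hk hh) (H.vgrp_le c l hl hg) with
    ⟨rfl, hgA⟩ | ⟨hbc, x, hx, z, hz, rfl, hxF⟩ | ⟨rfl, x, hx, y, hy, hyF, z, hz, rfl, hxF, hxyF⟩ |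
    ⟨x, hx, y, hy, hyF, z, hz, hzF, hxF, hxyF, hxyzF⟩
  · exact (H.classified b k hk l hl h hh h1 g hgA hg).mono (hsub b)
  · obtain ⟨c0, hc0, d, hd, p, hp, hp', hxA, hhk⟩ := hell x hx hxF
    have hc : c = !b := by cases b <;> cases c <;> simp_all
    subst hc
    have hzA : z⁻¹ * c0 ∈ A (!b) := mul_mem (inv_mem hz) (H.amalgam.le _ hc0)
    have hl' : (z⁻¹ * c0) * a d ^ p * (z⁻¹ * c0)⁻¹ ∈ vgrp a l := by
      rw [← hp']
      convert hg using 1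
      group
    have hz' : ∀ V : Subgroup G, z⁻¹ * c0 ∈ V → c0⁻¹ * z ∈ V := fun V h => by
      simpa using inv_mem h
    have hzp : ∀ p : ℤ, a d ^ p ∈ Subgroup.zpowers (a d) := zpow_mem (Subgroup.mem_zpowers _)
    -- One edge: `a d` is first on one side and last on the other, so `k` and `l` are `d` and `d -
    -- 1` in one of the two orders.
    rcases H.boundary_cases b hd with ⟨h2, h3, h4, h5⟩ | ⟨h2, h3, h4, h5⟩
    · obtain ⟨rfl, h6⟩ := H.first h2 h3 hxA hp hk hhk
      obtain ⟨rfl, h7⟩ := H.last h4 h5 hzA hp hl hl'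
      exact Or.inr (Or.inr (Or.inl ⟨by simp, _, h6, _, hz' _ h7, by group, hp' ▸ hzp p⟩))
    · obtain ⟨rfl, h6⟩ := H.last h4 h5 hxA hp hk hhk
      obtain ⟨rfl, h7⟩ := H.first h2 h3 hzA hp hl hl'
      exact Or.inr (Or.inl ⟨by simp, _, h6, _, hz' _ h7, by group, hp' ▸ hzp p⟩)
  · obtain ⟨c0, hc0, d, hd, p, hp, hp', hxA, hhk⟩ := hell x hx hxF
    -- Two edges: `a d` is last on the middle side `!b`, hence first on side `b`, where both end
    -- vertices must have index `d`.
    obtain ⟨h2, h3, c1, hc1, q, hq, hy', hq'⟩ := H.conj_boundary hd hp (y := c0⁻¹ * y)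
      (mul_mem (H.amalgam.le _ (inv_mem hc0)) hy)
      (by rwa [Subgroup.mul_mem_cancel_left _ (inv_mem hc0)]) (by
        rw [← hp']; convert hxyF using 1; group)
    rcases H.boundary_cases b hd with ⟨h4, h5, -, -⟩ | ⟨h4, -⟩
    swap
    · exact (h3 h4).elim
    obtain ⟨rfl, h6⟩ := H.first h4 h5 hxA hp hk hhk
    obtain ⟨rfl, h7⟩ := H.first h4 h5 (y := z⁻¹ * c1) (mul_mem (inv_mem hz) (H.amalgam.le _ hc1)) hq
      hl (by
        rw [← hq', ← hp']
        convert hg using 1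
        group)
    refine Or.inr (Or.inr (Or.inr ⟨rfl, l - 1, hsub _ h2, by simp, _, h6, _, hy', c1⁻¹ * z,
      by simpa using inv_mem h7, by group, ?_⟩))
    rw [hp']
    exact zpow_mem (Subgroup.mem_zpowers _) p
  -- Three edges: two consecutive inner vertices of the path would make `a d` the last generator on
  -- both sides.
  · exfalso
    obtain ⟨c0, hc0, d, hd, p, hp, hp', hxA, hhk⟩ := hell x hx hxF
    obtain ⟨h2, h3, c1, hc1, q, hq, hy', hq'⟩ := H.conj_boundary hd hp (y := c0⁻¹ * y)
      (mul_mem (H.amalgam.le _ (inv_mem hc0)) hy)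
      (by rwa [Subgroup.mul_mem_cancel_left _ (inv_mem hc0)]) (by
        rw [← hp']; convert hxyF using 1; group)
    obtain ⟨-, h4, -⟩ := H.conj_boundary hd hq (y := c1⁻¹ * z)
      (mul_mem (H.amalgam.le _ (inv_mem hc1)) hz)
      (by rwa [Subgroup.mul_mem_cancel_left _ (inv_mem hc1)]) (by
        rw [← hq', ← hp']; convert hxyzF using 1; group)
    rcases H.boundary_cases b hd with ⟨h5, -⟩ | ⟨h5, -⟩
    · exact h4 h5
    · exact h3 h5

end Splitting

end Classification

/-! ### Gluing presentations -/

section Gluing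

variable {n : ℕ}

/-- The generators that occur in the relations indexed by `S`. -/
def edges (S : Set (ZMod n)) : Set (ZMod n) := {i | i ∈ S ∨ i - 1 ∈ S}

lemma mem_edges {S : Set (ZMod n)} {k : ZMod n} (hk : k ∈ S) : k ∈ edges S := Or.inl hk

lemma add_one_mem_edges {S : Set (ZMod n)} {k : ZMod n} (hk : k ∈ S) : k + 1 ∈ edges S :=
  Or.inr (by simpa using hk)

lemma edges_union (S T : Set (ZMod n)) : edges (S ∪ T) = edges S ∪ edges T := by
  ext i
  simp only [edges, Set.mem_union, Set.mem_ofPred_eq]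
  tauto

/-- The group `G` is presented by the generators `a i`, `i ∈ edges S`, and the relations
`a k * a (k + 1) * (a k)⁻¹ = a (k + 1) ^ 2`, `k ∈ S`; its vertex groups are Baumslag-Solitar groups
whose intersections are classified. -/
structure Good (S : Set (ZMod n)) {G : Type} [Group G] (a : ZMod n → G) : Prop where
  rel : ∀ k ∈ S, a k * a (k + 1) * (a k)⁻¹ = a (k + 1) ^ 2
  gen : Subgroup.closure (a '' edges S) = ⊤
  univ : ∀ (K : Type) [Group K] (b : ZMod n → K),
    (∀ k ∈ S, b k * b (k + 1) * (b k)⁻¹ = b (k + 1) ^ 2) →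
    ∃ φ : G →* K, ∀ i ∈ edges S, φ (a i) = b i
  bs : ∀ k ∈ S, BSPair (a k) (a (k + 1))
  classified : Classified ⊤ S a

/-- The generators in `D` freely generate a subgroup, in which those elements that are conjugate
into vertex groups are conjugate to powers of the generators. -/
structure FreeEnds (D S : Set (ZMod n)) {G : Type} [Group G] (a : ZMod n → G) : Prop where
  injective : Function.Injective (FreeGroup.lift fun d : D => a d)
  elliptic : ∀ f ∈ (FreeGroup.lift fun d : D => a d).range, ∀ y, ∀ k ∈ S,
    y * f * y⁻¹ ∈ vgrp a k → ∃ c ∈ (FreeGroup.lift fun d : D => a d).range, ∃ d ∈ D, ∃ p : ℤ,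
      c⁻¹ * f * c = a d ^ p

lemma vgrp_map {G P : Type*} [Group G] [Group P] (f : G →* P) {a : ZMod n → G} {α : ZMod n → P}
    {k : ZMod n} (h : α k = f (a k)) (h' : α (k + 1) = f (a (k + 1))) :
    vgrp α k = (vgrp a k).map f := by
  rw [vgrp, vgrp, MonoidHom.map_closure, Set.image_pair, h, h']

lemma Near.map {G P : Type*} [Group G] [Group P] (f : G →* P) {a : ZMod n → G} {α : ZMod n → P}
    {S : Set (ZMod n)} (hα : ∀ i ∈ edges S, α i = f (a i)) {k l : ZMod n} (hk : k ∈ S) (hl : l ∈ S)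
    {h g : G} (H : Near S a k l h g) : Near S α k l (f h) (f g) := by
  have hV : ∀ k ∈ S, ∀ x ∈ vgrp a k, f x ∈ vgrp α k := fun k hk x hx => by
    rw [vgrp_map f (hα k (mem_edges hk)) (hα _ (add_one_mem_edges hk))]
    exact Subgroup.mem_map_of_mem f hx
  have hZ : ∀ k ∈ S, ∀ u, u⁻¹ * h * u ∈ Subgroup.zpowers (a k) →
      (f u)⁻¹ * f h * f u ∈ Subgroup.zpowers (α k) := fun k hk u hu => by
    rw [hα k (mem_edges hk), ← MonoidHom.map_zpowers, ← map_inv, ← map_mul, ← map_mul]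
    exact Subgroup.mem_map_of_mem f hu
  rcases H with ⟨h1, h2⟩ | ⟨h1, u, hu, v, hv, h2, h3⟩ | ⟨h1, u, hu, v, hv, h2, h3⟩ |
    ⟨h1, j, hj, h4, u, hu, v, hv, w, hw, h2, h3⟩
  · exact Or.inl ⟨h1, hV k hk g h2⟩
  · exact Or.inr (Or.inl ⟨h1, f u, hV k hk u hu, f v, hV l hl v hv, by rw [h2, map_mul],
      hZ l hl u h3⟩)
  · exact Or.inr (Or.inr (Or.inl ⟨h1, f u, hV k hk u hu, f v, hV l hl v hv, by rw [h2, map_mul],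
      hZ k hk u h3⟩))
  · exact Or.inr (Or.inr (Or.inr ⟨h1, j, hj, h4, f u, hV k hk u hu, f v, hV j hj v hv, f w,
      hV k hk w hw, by rw [h2, map_mul, map_mul], hZ k hk u h3⟩))

lemma Classified.map {G P : Type*} [Group G] [Group P] {f : G →* P} (hf : Function.Injective f)
    {a : ZMod n → G} {α : ZMod n → P} {S : Set (ZMod n)} (hα : ∀ i ∈ edges S, α i = f (a i))
    (H : Classified ⊤ S a) : Classified f.range S α := by
  intro k hk l hl h hh h1 g hg hgh
  rw [vgrp_map f (hα k (mem_edges hk)) (hα _ (add_one_mem_edges hk))] at hh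
  rw [vgrp_map f (hα l (mem_edges hl)) (hα _ (add_one_mem_edges hl))] at hgh
  obtain ⟨h, hh, rfl⟩ := hh
  obtain ⟨g, rfl⟩ := hg
  rw [← map_inv, ← map_mul, ← map_mul] at hgh
  have hgh' := (Subgroup.mem_map_iff_mem hf).1 hgh
  exact (H k hk l hl h hh (by rintro rfl; simp at h1) g trivial hgh').map f hα hk hl

/-- Groups presented by two sets of relations with free common boundary generators embed into the
group presented by all these relations, which is their amalgamated product. -/
theorem exists_glue {G : Bool → Type} [∀ b, Group (G b)] {S : Bool → Set (ZMod n)}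
    {a : ∀ b, ZMod n → G b} {D : Set (ZMod n)} (hD : edges (S true) ∩ edges (S false) = D)
    (hbd : ∀ d ∈ D, ∃ b, d ∈ S b ∧ d - 1 ∉ S b ∧ d - 1 ∈ S (!b) ∧ d ∉ S (!b))
    (hgood : ∀ b, Good (S b) (a b)) (hends : ∀ b, FreeEnds D (S b) (a b)) :
    ∃ (P : Type) (_ : Group P) (α : ZMod n → P) (A : Bool → Subgroup P),
      Good (S true ∪ S false) α ∧
        Splitting A (FreeGroup.lift fun d : D => α d).range S D α := by
  classical
  let φ : ∀ b, FreeGroup D →* G b := fun b => FreeGroup.lift fun d : D => a b d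
  have hφ : ∀ b, Function.Injective (φ b) := fun b => (hends b).injective
  have hφd : ∀ b (d : D), φ b (FreeGroup.of d) = a b d := fun b d => FreeGroup.lift_apply_of
  let P := Monoid.PushoutI φ
  let ι : ∀ b, G b →* P := fun b => Monoid.PushoutI.of b
  have hι : ∀ b, Function.Injective (ι b) := Monoid.PushoutI.of_injective hφ
  have hιφ : ∀ b w, ι b (φ b w) = Monoid.PushoutI.base φ w := Monoid.PushoutI.of_apply_eq_base φ
  -- On the shared generators `D` the two images agree in the pushout, so preferring the factor
  -- `true` is harmless.
  let α : ZMod n → P := fun i =>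
    if i ∈ edges (S true) then ι true (a true i) else ι false (a false i)
  have hα : ∀ b, ∀ i ∈ edges (S b), α i = ι b (a b i) := by
    intro b i hi
    cases b with
    | true => exact if_pos hi
    | false =>
      by_cases h : i ∈ edges (S true)
      · have hd : i ∈ D := hD ▸ ⟨h, hi⟩
        have h1 := hιφ true (FreeGroup.of ⟨i, hd⟩)
        rw [← hιφ false, hφd, hφd] at h1
        exact (if_pos h).trans h1
      · exact if_neg h
  have hDe : ∀ b, ∀ d ∈ D, d ∈ edges (S b) := by
    intro b d hd
    rw [← hD] at hd
    cases b
    · exact hd.2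
    · exact hd.1
  have hV : ∀ b, ∀ k ∈ S b, vgrp α k = (vgrp (a b) k).map (ι b) := fun b k hk =>
    vgrp_map (ι b) (hα b k (mem_edges hk)) (hα b _ (add_one_mem_edges hk))
  have hbase : FreeGroup.lift (fun d : D => α d) = Monoid.PushoutI.base φ := by
    ext d
    rw [FreeGroup.lift_apply_of, ← hιφ true, hφd, hα true d (hDe true d d.2)]
  have hbsb : ∀ b, ∀ k ∈ S b, BSPair (α k) (α (k + 1)) := fun b k hk => by
    rw [hα b k (mem_edges hk), hα b _ (add_one_mem_edges hk)]
    exact ((hgood b).bs k hk).map (hι b)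
  have hmem : ∀ k ∈ S true ∪ S false, ∃ b, k ∈ S b := fun k hk => hk.elim (⟨_, ·⟩) (⟨_, ·⟩)
  have hamal := isAmalgam_pushout φ hφ
  have hsplit : Splitting (fun b => (ι b).range) (FreeGroup.lift fun d : D => α d).range S D α := by
    rw [hbase]
    refine ⟨hamal, ?_, hbsb, fun b => (hgood b).classified.map (hι b) (hα b), hbd, ?_, ?_⟩
    · intro b k hk
      rw [hV b k hk]
      rintro _ ⟨x, -, rfl⟩
      exact ⟨x, rfl⟩
    · intro d hd
      rw [← hbase]
      exact ⟨FreeGroup.of ⟨d, hd⟩, FreeGroup.lift_apply_of⟩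
    · rintro b _ ⟨w, rfl⟩ _ ⟨y, rfl⟩ k hk h
      rw [hV b k hk, ← hιφ b, ← map_inv, ← map_mul, ← map_mul] at h
      obtain ⟨_, ⟨w', rfl⟩, d, hd, p, hp⟩ := (hends b).elliptic _ ⟨w, rfl⟩ y k hk
        ((Subgroup.mem_map_iff_mem (hι b)).1 h)
      refine ⟨_, ⟨w', rfl⟩, d, hd, p, ?_⟩
      rw [← hιφ b, ← hιφ b, hα b d (hDe b d hd), ← map_inv, ← map_mul, ← map_mul, ← map_zpow, ← hp]
  refine ⟨P, inferInstance, α, _, ⟨?_, ?_, ?_, ?_, hsplit.classified_union⟩, hsplit⟩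
  · intro k hk
    obtain ⟨b, hb⟩ := hmem k hk
    rw [hα b k (mem_edges hb), hα b _ (add_one_mem_edges hb), ← map_inv, ← map_mul, ← map_mul,
      (hgood b).rel k hb, map_pow]
  · rw [eq_top_iff, ← hamal.sup]
    have h1 : ∀ b, (ι b).range ≤ Subgroup.closure (α '' edges (S b)) := fun b => by
      rw [MonoidHom.range_eq_map, ← (hgood b).gen, MonoidHom.map_closure]
      refine Subgroup.closure_mono ?_
      rintro _ ⟨_, ⟨i, hi, rfl⟩, rfl⟩
      exact ⟨i, hi, hα b i hi⟩
    rw [edges_union, Set.image_union, Subgroup.closure_union]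
    exact sup_le_sup (h1 true) (h1 false)
  · intro K _ b hb
    have hf : ∀ c, ∃ f : G c →* K, ∀ i ∈ edges (S c), f (a c i) = b i := fun c =>
      (hgood c).univ K b fun k hk => hb k (by cases c; exacts [Or.inr hk, Or.inl hk])
    choose f hf using hf
    refine ⟨Monoid.PushoutI.lift f (FreeGroup.lift fun d : D => b d) ?_, ?_⟩
    · intro c
      ext d
      rw [MonoidHom.comp_apply, hφd, hf c _ (hDe c d d.2), FreeGroup.lift_apply_of]
    · intro i hi
      rw [edges_union] at hi
      have key : ∀ c, i ∈ edges (S c) →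
          Monoid.PushoutI.lift f (FreeGroup.lift fun d : D => b d) (by
            intro c
            ext d
            rw [MonoidHom.comp_apply, hφd, hf c _ (hDe c d d.2), FreeGroup.lift_apply_of])
            (α i) = b i := fun c hc => by
        rw [hα c i hc]
        exact (Monoid.PushoutI.lift_of f _ _ _).trans (hf c i hc)
      exact hi.elim (key true) (key false)
  · intro k hk
    obtain ⟨b, hb⟩ := hmem k hk
    exact hbsb b k hb

end Gluing

/-! ### Chains of generators and the Higman group -/

section Chains

variable {n : ℕ}

/-- The interval `{c, c + 1, …, c + (r - 1)}` of `ZMod n`. -/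
def chain (c : ZMod n) (r : ℕ) : Set (ZMod n) := {i | (i - c).val < r}

lemma add_natCast_mem_chain {c : ZMod n} {r j : ℕ} (hj : j < n) :
    c + (j : ZMod n) ∈ chain c r ↔ j < r := by
  rw [chain, Set.mem_ofPred_eq, add_sub_cancel_left, ZMod.val_natCast, Nat.mod_eq_of_lt hj]

lemma add_natCast_injective {c : ZMod n} {j k : ℕ} (hj : j < n) (hk : k < n)
    (h : c + (j : ZMod n) = c + (k : ZMod n)) : j = k := by
  have := congrArg ZMod.val (add_left_cancel h)
  rwa [ZMod.val_natCast, ZMod.val_natCast, Nat.mod_eq_of_lt hj, Nat.mod_eq_of_lt hk] at this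

lemma exists_eq_add_natCast [NeZero n] (c i : ZMod n) : ∃ j < n, i = c + (j : ZMod n) :=
  ⟨(i - c).val, ZMod.val_lt _, by rw [ZMod.natCast_zmod_val, add_sub_cancel]⟩

lemma sub_one_eq_add_natCast [NeZero n] (c : ZMod n) : c - 1 = c + ((n - 1 : ℕ) : ZMod n) := by
  rw [Nat.cast_sub (NeZero.one_le), ZMod.natCast_self, Nat.cast_one, zero_sub, sub_eq_add_neg]

lemma add_succ_sub_one (c : ZMod n) (j : ℕ) : c + ((j + 1 : ℕ) : ZMod n) - 1 = c + (j : ZMod n) := by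
  push_cast; ring

lemma sub_one_notMem_chain [NeZero n] {c : ZMod n} {r : ℕ} (hr : r < n) : c - 1 ∉ chain c r := by
  have := NeZero.pos n
  rw [sub_one_eq_add_natCast, add_natCast_mem_chain (by omega)]
  omega

lemma self_mem_chain {c : ZMod n} {r : ℕ} (hr : 0 < r) : c ∈ chain c r := by
  simpa [chain] using hr

lemma mem_edges_chain [NeZero n] {c : ZMod n} {r j : ℕ} (hj : j < n) (hr : 0 < r) :
    c + (j : ZMod n) ∈ edges (chain c r) ↔ j ≤ r := by
  rw [edges, Set.mem_ofPred_eq, add_natCast_mem_chain hj]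
  cases j with
  | zero =>
    simp [hr]
  | succ j =>
    rw [add_succ_sub_one, add_natCast_mem_chain (by omega)]
    omega

lemma chain_one (c : ZMod n) [NeZero n] : chain c 1 = {c} := by
  ext i
  rw [chain, Set.mem_ofPred_eq, Nat.lt_one_iff, ZMod.val_eq_zero, sub_eq_zero, Set.mem_singleton_iff]

lemma chain_succ [NeZero n] (c : ZMod n) {r : ℕ} (hr : r < n) :
    chain c (r + 1) = chain c r ∪ chain (c + (r : ZMod n)) 1 := by
  ext i
  obtain ⟨j, hj, rfl⟩ := exists_eq_add_natCast c i
  rw [chain_one, Set.mem_union, Set.mem_singleton_iff, add_natCast_mem_chain hj,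
    add_natCast_mem_chain hj]
  constructor
  · intro h
    rcases Nat.lt_succ_iff_lt_or_eq.1 h with h | rfl
    · exact Or.inl h
    · exact Or.inr rfl
  · rintro (h | h)
    · omega
    · have := add_natCast_injective hj hr h
      omega

/-- The only vertex group is the whole group, so the classification reduces to its first
alternative. -/
lemma exists_good_singleton (hn : 1 < n) (c : ZMod n) :
    ∃ (G : Type) (_ : Group G) (a : ZMod n → G), Good {c} a := by
  classical
  have : Fact (1 < n) := ⟨hn⟩
  obtain ⟨G, _, s, t, hrel, hgen, hbs, huniv⟩ := exists_bs
  let a : ZMod n → G := fun i => if i = c then s else t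
  have h0 : a c = s := if_pos rfl
  have h1 : a (c + 1) = t := if_neg (by simp)
  have hE : edges {c} = {c, c + 1} := by
    ext i
    simp [edges, sub_eq_iff_eq_add]
  refine ⟨G, inferInstance, a, ?_, ?_, ?_, ?_, ?_⟩
  · rintro _ rfl
    rw [h0, h1, hrel]
  · rw [hE, Set.image_pair, h0, h1, hgen]
  · intro K _ b hb
    obtain ⟨φ, hs, ht⟩ := huniv K _ _ (hb c rfl)
    refine ⟨φ, ?_⟩
    rw [hE]
    rintro _ (rfl | rfl)
    · rw [h0, hs]
    · rw [h1, ht]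
  · rintro _ rfl
    rw [h0, h1]
    exact hbs
  · rintro _ rfl _ rfl h _ _ g _ _
    refine Or.inl ⟨rfl, ?_⟩
    rw [vgrp, h0, h1, hgen]
    trivial

lemma freeGroup_singleton {d : ZMod n} (w : FreeGroup ({d} : Set (ZMod n))) :
    ∃ p : ℤ, w = FreeGroup.of ⟨d, rfl⟩ ^ p := by
  have h : w ∈ Subgroup.closure (Set.range (FreeGroup.of (α := ({d} : Set (ZMod n))))) := by
    rw [FreeGroup.closure_range_of]; trivial
  have h1 : Set.range (FreeGroup.of (α := ({d} : Set (ZMod n)))) = {FreeGroup.of ⟨d, rfl⟩} := by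
    ext x
    constructor
    · rintro ⟨⟨_, rfl⟩, rfl⟩; rfl
    · rintro rfl; exact ⟨_, rfl⟩
  rw [h1, Subgroup.mem_closure_singleton] at h
  exact h.imp fun _ h => h.symm

/-- A generator has infinite order, and every element of the free group of rank one is already a
power of it. -/
lemma Good.freeEnds_singleton {S : Set (ZMod n)} {G : Type} [Group G] {a : ZMod n → G}
    (H : Good S a) {d : ZMod n} (hd : d ∈ edges S) : FreeEnds {d} S a := by
  have hinf : ∀ p : ℤ, a d ^ p = 1 → p = 0 := by
    rcases hd with hd | hd
    · exact fun p hp => (H.bs d hd).zpow_fst hp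
    · simpa using (H.bs _ hd).zpow_snd
  constructor
  · rw [injective_iff_map_eq_one]
    intro w hw
    obtain ⟨p, rfl⟩ := freeGroup_singleton w
    rw [map_zpow, FreeGroup.lift_apply_of] at hw
    rw [hinf p hw, zpow_zero]
  · rintro _ ⟨w, rfl⟩ y k _ _
    obtain ⟨p, rfl⟩ := freeGroup_singleton w
    exact ⟨1, one_mem _, d, rfl, p, by simp⟩

/-- The ends of the union of a chain and the next edge are free. -/
lemma Splitting.freeEnds [NeZero n] {S : Bool → Set (ZMod n)} {c d : ZMod n} {P : Type} [Group P]
    {α : ZMod n → P} {A : Bool → Subgroup P}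
    (H : Splitting A (FreeGroup.lift fun e : ({d} : Set (ZMod n)) => α e).range S {d} α)
    (hc : c ∈ S true) (hc' : c - 1 ∉ S true) (hd : d ∈ S false) (hd' : d - 1 ∈ S true)
    (hcd : c ≠ d + 1) : FreeEnds {c, d + 1} (S true ∪ S false) α := by
  classical
  let D : Set (ZMod n) := {c, d + 1}
  let σ : D → Bool := fun e => decide ((e : ZMod n) = c)
  have hσ : Function.Injective σ := by
    have hiff : ∀ e : D, σ e = true ↔ (e : ZMod n) = c := fun e => by simp [σ]
    intro x y h
    by_cases hx : (x : ZMod n) = c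
    · exact Subtype.ext (hx.trans ((hiff y).1 (h ▸ (hiff x).2 hx)).symm)
    · have hy : (y : ZMod n) ≠ c := fun hy => hx ((hiff x).1 (h ▸ (hiff y).2 hy))
      exact Subtype.ext ((x.2.resolve_left hx).trans (y.2.resolve_left hy).symm)
  have : Nonempty D := ⟨⟨c, Or.inl rfl⟩⟩
  have hu : ∀ e : D, α e ∈ A (σ e) := by
    rintro ⟨x, rfl | rfl⟩
    · simpa [σ] using H.vgrp_le true x hc (fst_mem_vgrp α x)
    · have : σ ⟨d + 1, Or.inr rfl⟩ = false := by simp [σ, hcd.symm]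
      rw [this]
      exact H.vgrp_le false d hd (snd_mem_vgrp α d)
  -- A power of `a c` in `⟨a d⟩` forces `c = d - 1`, since `a c` is first in its chain. In either
  -- case, powers of two consecutive generators would agree, which `not_conj` excludes.
  have hF : ∀ e : D, ∀ p : ℤ, α e ^ p ∈
      (FreeGroup.lift fun e : ({d} : Set (ZMod n)) => α e).range → p = 0 := by
    rintro ⟨x, hx⟩ p ⟨w, hw⟩
    obtain ⟨q, rfl⟩ := freeGroup_singleton w
    rw [map_zpow, FreeGroup.lift_apply_of] at hw
    rcases hx with rfl | rfl
    · by_contra hp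
      obtain ⟨h1, -⟩ := H.first hc hc' (one_mem _) hp hd' (by
        simpa [← hw] using zpow_mem (mem_vgrp_sub_one α d) q)
      refine hp ((H.bs true x hc).not_conj 1 (one_mem _) p q ?_)
      rw [← h1, sub_add_cancel, hw, h1]
      simp
    · have hq : q = 0 := (H.bs false d hd).not_conj 1 (one_mem _) q p (by simpa using hw)
      rw [hq, zpow_zero] at hw
      exact (H.bs false d hd).zpow_snd p hw.symm
  refine ⟨H.amalgam.lift_injective hσ hu hF, fun f hf y k hk h => ?_⟩
  have hk' : ∃ b, k ∈ S b := hk.elim (⟨_, ·⟩) (⟨_, ·⟩)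
  obtain ⟨b, hb⟩ := hk'
  obtain ⟨k, hk, e, p, h1⟩ := H.amalgam.exists_conj_eq_zpow hσ hu hF hf (H.vgrp_le b k hb h)
  exact ⟨k, hk, e, e.2, p, h1⟩

/-- A chain is extended by a Baumslag-Solitar group along one infinite cyclic group. The ends are
free only from length two on: for `r = 1` they satisfy the defining relation. The bound `r < n`
keeps the two ends distinct. -/
theorem exists_good_chain (c : ZMod n) {r : ℕ} (hr : 1 ≤ r) (hrn : r < n) :
    ∃ (G : Type) (_ : Group G) (a : ZMod n → G), Good (chain c r) a ∧
      (2 ≤ r → FreeEnds {c, c + (r : ZMod n)} (chain c r) a) := by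
  have : NeZero n := ⟨by omega⟩
  induction r, hr using Nat.le_induction with
  | base =>
    obtain ⟨G, _, a, ha⟩ := exists_good_singleton hrn c
    exact ⟨G, inferInstance, a, by rwa [chain_one], fun h => by omega⟩
  | succ r hr ih =>
    obtain ⟨G₁, i₁, a₁, h₁, -⟩ := ih (by omega)
    obtain ⟨G₂, i₂, a₂, h₂⟩ := exists_good_singleton (by omega : 1 < n) (c + (r : ZMod n))
    rw [← chain_one] at h₂
    let G : Bool → Type := fun b => if b then G₁ else G₂
    let ig : ∀ b, Group (G b) := fun b => by cases b; exacts [i₂, i₁]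
    let a : ∀ b, ZMod n → G b := fun b => by cases b; exacts [a₂, a₁]
    let S : Bool → Set (ZMod n) := fun b => if b then chain c r else chain (c + (r : ZMod n)) 1
    have hS1 : S true = chain c r := rfl
    have hS2 : S false = chain (c + (r : ZMod n)) 1 := rfl
    have hgood : ∀ b, Good (S b) (a b) := fun b => by cases b; exacts [h₂, h₁]
    have hr1 : c + (r : ZMod n) - 1 = c + ((r - 1 : ℕ) : ZMod n) := by
      rw [← add_succ_sub_one c (r - 1), Nat.sub_add_cancel hr]
    have hd2 : c + (r : ZMod n) ∈ S false := self_mem_chain one_pos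
    have hd1 : c + (r : ZMod n) - 1 ∈ S true := by
      rw [hr1, hS1, add_natCast_mem_chain (by omega)]
      omega
    have hD : edges (S true) ∩ edges (S false) = {c + (r : ZMod n)} := by
      ext i
      rw [Set.mem_inter_iff, Set.mem_singleton_iff]
      constructor
      · rintro ⟨hi, h | h⟩
        · rwa [hS2, chain_one, Set.mem_singleton_iff] at h
        · rw [hS2, chain_one, Set.mem_singleton_iff, sub_eq_iff_eq_add] at h
          have : i = c + ((r + 1 : ℕ) : ZMod n) := by rw [h]; push_cast; ring
          rw [this, hS1, mem_edges_chain (by omega) (by omega)] at hi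
          omega
      · rintro rfl
        exact ⟨Or.inr hd1, Or.inl hd2⟩
    obtain ⟨P, _, α, A, hP, hsplit⟩ := exists_glue (G := G) (S := S) (a := a) hD (by
      rintro _ rfl
      refine ⟨false, hd2, sub_one_notMem_chain (by omega), hd1, ?_⟩
      rw [Bool.not_false, hS1, add_natCast_mem_chain (by omega)]
      omega) hgood (fun b => by
        refine (hgood b).freeEnds_singleton ?_
        cases b
        · exact Or.inl hd2
        · exact Or.inr hd1)
    have hunion : S true ∪ S false = chain c (r + 1) := (chain_succ c (by omega)).symm
    refine ⟨P, inferInstance, α, hunion ▸ hP, fun _ => ?_⟩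
    have := hsplit.freeEnds (c := c) (self_mem_chain (by omega)) (sub_one_notMem_chain (by omega))
      hd2 hd1 (by
        intro h
        have h' : c + ((0 : ℕ) : ZMod n) = c + ((r + 1 : ℕ) : ZMod n) := by
          push_cast
          rw [add_zero, ← add_assoc]
          exact h
        have := add_natCast_injective (by omega) hrn h'
        omega)
    rw [hunion] at this
    convert this using 2
    push_cast
    rw [add_assoc]

/-- The cycle is cut at `0` and `2` into chains of lengths `2` and `n - 2`. Both have length at
least two, so each has free ends; this is where `4 ≤ n` enters. -/
theorem exists_good_univ (hn : 4 ≤ n) :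
    ∃ (G : Type) (_ : Group G) (a : ZMod n → G), Good Set.univ a := by
  have : NeZero n := ⟨by omega⟩
  obtain ⟨G₁, i₁, a₁, h₁, e₁⟩ := exists_good_chain (0 : ZMod n) (r := 2) (by omega) (by omega)
  obtain ⟨G₂, i₂, a₂, h₂, e₂⟩ := exists_good_chain (2 : ZMod n) (r := n - 2) (by omega) (by omega)
  let G : Bool → Type := fun b => if b then G₁ else G₂
  let ig : ∀ b, Group (G b) := fun b => by cases b; exacts [i₂, i₁]
  let a : ∀ b, ZMod n → G b := fun b => by cases b; exacts [a₂, a₁]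
  let S : Bool → Set (ZMod n) := fun b => if b then chain 0 2 else chain 2 (n - 2)
  have hS1 : S true = chain 0 2 := rfl
  have hS2 : S false = chain 2 (n - 2) := rfl
  have hcast : ∀ j : ℕ, (j : ZMod n) = 0 + (j : ZMod n) := fun j => by rw [zero_add]
  have hcast2 : ∀ j : ℕ, 2 ≤ j → (j : ZMod n) = 2 + ((j - 2 : ℕ) : ZMod n) := fun j hj => by
    rw [Nat.cast_sub hj]; push_cast; ring
  -- For `j < 2`, the offset from the base point `2` of the second chain wraps around.
  have hcastn : ∀ j : ℕ, (j : ZMod n) = 2 + ((n + j - 2 : ℕ) : ZMod n) := fun j => by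
    rw [← hcast2 (n + j) (by omega)]; simp
  have m1 : ∀ j < n, (j : ZMod n) ∈ S true ↔ j < 2 := fun j hj => by
    rw [hcast, hS1, add_natCast_mem_chain hj]
  have m2 : ∀ j < n, (j : ZMod n) ∈ S false ↔ 2 ≤ j := fun j hj => by
    by_cases h : 2 ≤ j
    · rw [hcast2 j h, hS2, add_natCast_mem_chain (by omega)]
      omega
    · rw [hcastn, hS2, add_natCast_mem_chain (by omega)]
      omega
  have n1 : ∀ j < n, (j : ZMod n) ∈ edges (S true) ↔ j ≤ 2 := fun j hj => by
    rw [hcast, hS1, mem_edges_chain hj (by omega)]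
  have n2 : ∀ j < n, (j : ZMod n) ∈ edges (S false) ↔ 2 ≤ j ∨ j = 0 := fun j hj => by
    by_cases h : 2 ≤ j
    · rw [hcast2 j h, hS2, mem_edges_chain (by omega) (by omega)]
      omega
    · rw [hcastn, hS2, mem_edges_chain (by omega) (by omega)]
      omega
  have h0 : (0 : ZMod n) = ((0 : ℕ) : ZMod n) := by simp
  have h2 : (2 : ZMod n) = ((2 : ℕ) : ZMod n) := by simp
  have h01 : (0 : ZMod n) - 1 = ((n - 1 : ℕ) : ZMod n) := by rw [sub_one_eq_add_natCast, zero_add]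
  have h21 : (2 : ZMod n) - 1 = ((1 : ℕ) : ZMod n) := by push_cast; ring
  have hD : edges (S true) ∩ edges (S false) = {0, 2} := by
    ext i
    obtain ⟨j, hj, hi⟩ := exists_eq_add_natCast 0 i
    rw [zero_add] at hi
    subst hi
    rw [Set.mem_inter_iff, n1 j hj, n2 j hj, Set.mem_insert_iff, Set.mem_singleton_iff]
    constructor
    · rintro ⟨h3, h4⟩
      obtain rfl | rfl : j = 0 ∨ j = 2 := by omega
      · simp
      · simp
    · rintro (h | h)
      · have : j = 0 := add_natCast_injective (c := (0 : ZMod n)) hj (by omega) (by rw [h]; simp)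
        omega
      · have : j = 2 := add_natCast_injective (c := (0 : ZMod n)) hj (by omega) (by rw [h]; simp)
        omega
  have hends : ∀ b, FreeEnds {0, 2} (S b) (a b) := by
    intro b
    cases b
    · have := e₂ (by omega)
      rw [← hcast2 n (by omega), ZMod.natCast_self, Set.pair_comm] at this
      exact this
    · have := e₁ le_rfl
      rw [Nat.cast_ofNat, zero_add] at this
      exact this
  obtain ⟨P, _, α, A, hP, -⟩ := exists_glue (G := G) (S := S) (a := a) hD (by
    rintro _ (rfl | rfl)
    · refine ⟨true, ?_, ?_, ?_, ?_⟩
      · rw [h0, m1 0 (by omega)]; omega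
      · rw [h01, m1 _ (by omega)]; omega
      · rw [h01, Bool.not_true, m2 _ (by omega)]; omega
      · rw [h0, Bool.not_true, m2 0 (by omega)]; omega
    · refine ⟨false, ?_, ?_, ?_, ?_⟩
      · rw [h2, m2 2 (by omega)]
      · rw [h21, m2 1 (by omega)]; omega
      · rw [h21, Bool.not_false, m1 1 (by omega)]; omega
      · rw [h2, Bool.not_false, m1 2 (by omega)]; omega)
    (fun b => by cases b; exacts [h₂, h₁]) hends
  have huniv : S true ∪ S false = Set.univ := by
    ext i
    obtain ⟨j, hj, hi⟩ := exists_eq_add_natCast 0 i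
    rw [zero_add] at hi
    subst hi
    rw [Set.mem_union, m1 j hj, m2 j hj]
    simp
    omega
  exact ⟨P, inferInstance, α, huniv ▸ hP⟩

/-! ### Transfer from the glued group to the Higman group -/

lemma gen_rel (n : ℕ) (k : ZMod n) :
    gen n k * gen n (k + 1) * (gen n k)⁻¹ = gen n (k + 1) ^ 2 :=
  mul_inv_eq_one.1 (PresentedGroup.one_of_mem (rels := rels n) ⟨k, rfl⟩)

/-- The intersections of conjugates of the vertex groups of the generalised Higman group. -/
theorem classified_higmanGroup (hn : 4 ≤ n) : Classified ⊤ Set.univ (gen n) := by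
  obtain ⟨P, _, α, hP⟩ := exists_good_univ hn
  obtain ⟨φ, hφ⟩ := hP.univ (HigmanGroup n) (gen n) fun k _ => gen_rel n k
  have hr : ∀ r ∈ rels n, FreeGroup.lift α r = 1 := by
    rintro _ ⟨k, rfl⟩
    simp [hP.rel k trivial]
  let ψ : HigmanGroup n →* P := PresentedGroup.toGroup hr
  have hψ : ∀ k, ψ (gen n k) = α k := fun k => PresentedGroup.toGroup.of hr
  -- This one-sided inverse suffices: it makes `ψ` injective, and `φ` carries the configuration
  -- found in `P` back.
  have hφψ : ∀ x, φ (ψ x) = x := fun x => by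
    have : φ.comp ψ = MonoidHom.id _ := PresentedGroup.ext fun k => by
      exact (congrArg φ (hψ k)).trans (hφ k (Or.inl trivial))
    exact DFunLike.congr_fun this x
  have hV : ∀ k, ∀ x ∈ vgrp (gen n) k, ψ x ∈ vgrp α k := fun k x hx => by
    rw [vgrp_map ψ (hψ k).symm (hψ _).symm]
    exact Subgroup.mem_map_of_mem ψ hx
  intro k _ l _ h hh h1 g _ hg
  have := (hP.classified k trivial l trivial (ψ h) (hV k h hh)
    (fun h0 => h1 (by rw [← hφψ h, h0, map_one])) (ψ g) trivial
    (by simpa using hV l _ hg)).map φ (fun i hi => (hφ i hi).symm) trivial trivial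
  rwa [hφψ, hφψ] at this

end Chains

/-! ### Sides and corners of the polygon -/

section Polygon

variable {n : ℕ}

lemma circumradius_pos (hn : 5 ≤ n) : 0 < circumradius n := by
  have hn' : (5 : ℝ) ≤ n := by exact_mod_cast hn
  have h1 : Real.pi / n < Real.pi / 4 :=
    div_lt_div_of_pos_left Real.pi_pos (by norm_num) (by linarith)
  have h0 : 0 < Real.pi / n := div_pos Real.pi_pos (by linarith)
  have h2 := Real.tan_pos_of_pos_of_lt_pi_div_two h0 (by linarith [Real.pi_pos])
  have h3 : Real.tan (Real.pi / n) < 1 := by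
    rw [← Real.tan_pi_div_four]
    exact Real.tan_lt_tan_of_nonneg_of_lt_pi_div_two h0.le (by linarith [Real.pi_pos]) h1
  exact Real.sqrt_pos.2 (by nlinarith)

lemma cos_lt_cos_of_lt_of_lt {a x : ℝ} (ha : 0 ≤ a) (h1 : a < x) (h2 : x < 2 * Real.pi - a) :
    Real.cos x < Real.cos a := by
  rcases le_total x Real.pi with hx | hx
  · exact Real.cos_lt_cos_of_nonneg_of_le_pi ha hx h1
  · rw [← Real.cos_two_pi_sub x]
    exact Real.cos_lt_cos_of_nonneg_of_le_pi ha (by linarith) (by linarith)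

lemma corner_eq [NeZero n] (k : ZMod n) : corner n k = circumradius n * ZMod.stdAddChar k := by
  rw [corner, ZMod.stdAddChar_apply, ZMod.toCircle_apply]
  congr 2
  ring

/-- The linear functional that is maximal, among the points of the polygon, on the `i`-th side. -/
noncomputable def sideFun (n : ℕ) [NeZero n] (i : ZMod n) (z : ℂ) : ℝ :=
  (z * (ZMod.stdAddChar (-i) * Complex.exp ((Real.pi / n : ℝ) * Complex.I))).re

lemma sideFun_combination [NeZero n] (i : ZMod n) (s t : ℝ) (z w : ℂ) :
    sideFun n i (s • z + t • w) = s * sideFun n i z + t * sideFun n i w := by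
  simp only [sideFun, add_mul, Complex.real_smul, mul_assoc, Complex.add_re, Complex.re_ofReal_mul]

/-- The outer normal of side `i` points halfway between its ends, at angle `-π / n` from the corner
`i`; this accounts for the odd multiples of `π / n`. -/
lemma sideFun_corner [NeZero n] (i : ZMod n) (m : ℕ) : sideFun n i (corner n (i + (m : ZMod n))) =
    circumradius n * Real.cos ((2 * m + 1) * (Real.pi / n)) := by
  have h : (ZMod.stdAddChar (i + (m : ZMod n)) : ℂ) * ZMod.stdAddChar (-i) =
      Complex.exp ((2 * m * (Real.pi / n) : ℝ) * Complex.I) := by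
    rw [← AddChar.map_add_eq_mul, add_neg_cancel_comm]
    have := ZMod.stdAddChar_coe (N := n) (m : ℤ)
    rw [Int.cast_natCast] at this
    rw [this]
    congr 1
    push_cast
    ring
  rw [sideFun, corner_eq, mul_assoc, Complex.re_ofReal_mul, ← mul_assoc, h, ← Complex.exp_add,
    ← add_mul, ← Complex.ofReal_add, Complex.exp_ofReal_mul_I_re]
  ring_nf

/-- Among the angles `(2m + 1)π / n` with `0 ≤ m < n`, the cosine is largest exactly at `m = 0` and
`m = n - 1`, that is, at the two ends of the side. -/
lemma sideFun_corner_le (hn : 5 ≤ n) [NeZero n] (i k : ZMod n) :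
    sideFun n i (corner n k) ≤ circumradius n * Real.cos (Real.pi / n) ∧
    (sideFun n i (corner n k) = circumradius n * Real.cos (Real.pi / n) ↔ k = i - 1 ∨ k = i) := by
  obtain ⟨m, hm, rfl⟩ := exists_eq_add_natCast i k
  have hn' : (0 : ℝ) < n := by exact_mod_cast (by omega : 0 < n)
  have hpos : 0 < Real.pi / n := div_pos Real.pi_pos hn'
  have hpi : (n : ℝ) * (Real.pi / n) = Real.pi := by field_simp
  have hr := circumradius_pos hn
  rw [sideFun_corner]
  by_cases h0 : m = 0
  · subst h0
    simp
  by_cases h1 : m = n - 1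
  · have h2 : ((m : ℕ) : ℝ) = n - 1 := by rw [h1, Nat.cast_sub (by omega), Nat.cast_one]
    have h3 : (2 * (m : ℝ) + 1) * (Real.pi / n) = 2 * Real.pi - Real.pi / n := by
      rw [h2]; linear_combination 2 * hpi
    rw [h3, Real.cos_two_pi_sub]
    refine ⟨le_rfl, fun _ => Or.inl ?_, fun _ => rfl⟩
    rw [h1, sub_one_eq_add_natCast]
  · have h2 : (1 : ℝ) ≤ m := by exact_mod_cast (by omega : 1 ≤ m)
    have h3 : (m : ℝ) + 2 ≤ n := by exact_mod_cast (by omega : m + 2 ≤ n)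
    have hlt := cos_lt_cos_of_lt_of_lt hpos.le (x := (2 * (m : ℝ) + 1) * (Real.pi / n))
      (by nlinarith) (by nlinarith)
    have hlt' := mul_lt_mul_of_pos_left hlt hr
    refine ⟨hlt'.le, fun h => absurd h hlt'.ne, fun h => ?_⟩
    rcases h with h | h
    · rw [sub_one_eq_add_natCast] at h
      exact (h1 (add_natCast_injective hm (by omega) h)).elim
    · have : i + (m : ZMod n) = i + ((0 : ℕ) : ZMod n) := by rw [h]; simp
      exact (h0 (add_natCast_injective hm (by omega) this)).elim

lemma sideFun_of_mem_side (hn : 5 ≤ n) [NeZero n] {i : ZMod n} {z : ℂ} (hz : z ∈ side n i) :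
    sideFun n i z = circumradius n * Real.cos (Real.pi / n) := by
  obtain ⟨s, t, _, _, hst, rfl⟩ := hz
  rw [sideFun_combination, ((sideFun_corner_le hn i (i - 1)).2).2 (Or.inl rfl),
    ((sideFun_corner_le hn i i).2).2 (Or.inr rfl), ← add_mul, hst, one_mul]

lemma corner_mem_side_iff (hn : 5 ≤ n) {i k : ZMod n} :
    corner n k ∈ side n i ↔ i = k ∨ i = k + 1 := by
  have : NeZero n := ⟨by omega⟩
  constructor
  · intro h
    rcases ((sideFun_corner_le hn i k).2).1 (sideFun_of_mem_side hn h) with rfl | rfl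
    · exact Or.inr (by ring)
    · exact Or.inl rfl
  · rintro (rfl | rfl)
    · exact right_mem_segment ℝ _ _
    · rw [side, add_sub_cancel_right]
      exact left_mem_segment ℝ _ _

/-- Two different sides meet in corners only. -/
lemma exists_eq_corner (hn : 5 ≤ n) {i j : ZMod n} (hij : i ≠ j) {z : ℂ} (hi : z ∈ side n i)
    (hj : z ∈ side n j) : ∃ k, z = corner n k := by
  have : NeZero n := ⟨by omega⟩
  have hz := sideFun_of_mem_side hn hi
  obtain ⟨s, t, hs, ht, hst, rfl⟩ := hj
  rcases hs.eq_or_lt with rfl | hs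
  · rw [zero_add] at hst
    exact ⟨j, by simp [hst]⟩
  rcases ht.eq_or_lt with rfl | ht
  · rw [add_zero] at hst
    exact ⟨j - 1, by simp [hst]⟩
  exfalso
  rw [sideFun_combination] at hz
  have h1 := sideFun_corner_le hn i (j - 1)
  have h2 := sideFun_corner_le hn i j
  set M := circumradius n * Real.cos (Real.pi / n)
  have hM : s * M + t * M = M := by rw [← add_mul, hst, one_mul]
  -- A maximum at an inner point of side `j` is a maximum at both of its ends, so these would be the
  -- ends of side `i`.
  have e1 : sideFun n i (corner n (j - 1)) = M := by
    by_contra h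
    linarith [mul_lt_mul_of_pos_left (lt_of_le_of_ne h1.1 h) hs,
      mul_le_mul_of_nonneg_left h2.1 ht.le]
  have e2 : sideFun n i (corner n j) = M := by
    by_contra h
    linarith [mul_lt_mul_of_pos_left (lt_of_le_of_ne h2.1 h) ht,
      mul_le_mul_of_nonneg_left h1.1 hs.le]
  rcases h2.2.1 e2 with hj | hj
  · subst hj
    have htwo : ∀ m : ℕ, 0 < m → m < n → (m : ZMod n) ≠ 0 := fun m hm hmn h => by
      rw [ZMod.natCast_eq_zero_iff] at h
      exact absurd (Nat.le_of_dvd hm h) (by omega)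
    rcases h1.2.1 e1 with h | h
    · refine htwo 1 one_pos (by omega) ?_
      push_cast
      linear_combination -h
    · refine htwo 2 two_pos (by omega) ?_
      push_cast
      linear_combination -h
  · exact hij hj.symm

lemma localGroup_cornerPt (hn : 5 ≤ n) (k : ZMod n) :
    localGroup n (cornerPt n k) = vgrp (gen n) k := by
  rw [localGroup, vgrp, ← Set.image_pair]
  congr 2
  ext i
  exact corner_mem_side_iff hn

/-- Local groups grow towards the corners: a point inside side `i` has local group `⟨a_i⟩`,
contained in `V_i`, and an interior point of the polygon has no nontrivial `h`. -/
lemma exists_localGroup_le (hn : 5 ≤ n) (p : polygon n) {h : HigmanGroup n}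
    (hh : h ∈ localGroup n p) (h1 : h ≠ 1) : ∃ k, h ∈ vgrp (gen n) k := by
  by_cases hp : ∃ k, p = cornerPt n k
  · obtain ⟨k, rfl⟩ := hp
    exact ⟨k, localGroup_cornerPt hn k ▸ hh⟩
  by_cases he : ∃ i, (p : ℂ) ∈ side n i
  · obtain ⟨i, hi⟩ := he
    refine ⟨i, (Subgroup.closure_mono ?_ : localGroup n p ≤ vgrp (gen n) i) hh⟩
    rintro _ ⟨j, hj, rfl⟩
    by_cases hij : i = j
    · subst hij; exact Or.inl rfl
    · obtain ⟨k, hk⟩ := exists_eq_corner hn hij hi hj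
      exact (hp ⟨k, Subtype.ext hk⟩).elim
  · refine (h1 ?_).elim
    have : {i | (p : ℂ) ∈ side n i} = ∅ := by
      ext i; exact ⟨fun h => he ⟨i, h⟩, fun h => h.elim⟩
    rwa [localGroup, this, Set.image_empty, Subgroup.closure_empty, Subgroup.mem_bot] at hh

/-- An upper bound for the diameter of the polygon. -/
noncomputable def diamBound (n : ℕ) : ℝ := Real.arcosh (2 / (1 - circumradius n ^ 2))

lemma norm_le_circumradius (p : polygon n) : ‖(p : ℂ)‖ ≤ circumradius n := by
  have h : polygon n ⊆ Metric.closedBall 0 (circumradius n) := by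
    refine convexHull_min ?_ (convex_closedBall _ _)
    rintro _ ⟨k, rfl⟩
    simp [norm_corner]
  simpa using h p.2

/-- In the quotient inside `arcosh`, the numerator is at most `2`, and both factors under the root
are at least `1 - circumradius n ^ 2`. -/
lemma kleinDist_le_diamBound (hn : 5 ≤ n) (p q : polygon n) : kleinDist p q ≤ diamBound n := by
  have hr := circumradius_lt_one hn
  have hr0 := circumradius_pos hn
  have hA := klein_arg_ge (norm_lt_one hn p) (norm_lt_one hn q)
  have hc : 0 < 1 - circumradius n ^ 2 := by nlinarith
  have hp : 1 - circumradius n ^ 2 ≤ 1 - ‖(p : ℂ)‖ ^ 2 := by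
    nlinarith [norm_nonneg (p : ℂ), norm_le_circumradius p]
  have hq : 1 - circumradius n ^ 2 ≤ 1 - ‖(q : ℂ)‖ ^ 2 := by
    nlinarith [norm_nonneg (q : ℂ), norm_le_circumradius q]
  have hs : 1 - circumradius n ^ 2 ≤ Real.sqrt ((1 - ‖(p : ℂ)‖ ^ 2) * (1 - ‖(q : ℂ)‖ ^ 2)) := by
    apply Real.le_sqrt_of_sq_le
    rw [sq]
    exact mul_le_mul hp hq hc.le (hc.le.trans hp)
  have hin : 1 - inner ℝ (p : ℂ) (q : ℂ) ≤ 2 := by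
    have := (abs_le.1 (abs_real_inner_le_norm (p : ℂ) (q : ℂ))).1
    nlinarith [norm_nonneg (p : ℂ), norm_nonneg (q : ℂ), norm_lt_one hn p, norm_lt_one hn q]
  have hle : (1 - inner ℝ (p : ℂ) (q : ℂ)) /
      Real.sqrt ((1 - ‖(p : ℂ)‖ ^ 2) * (1 - ‖(q : ℂ)‖ ^ 2)) ≤ 2 / (1 - circumradius n ^ 2) :=
    div_le_div₀ (by norm_num) hin hc hs
  have h1 : 0 ≤ ‖(p : ℂ) - q‖ ^ 2 / 2 := by positivity
  exact (Real.arcosh_le_arcosh (by linarith) (by linarith)).2 hle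

end Polygon

/-! ### Stabilisers in the complex -/

section Action

variable {n : ℕ}

lemma smul_pt_eq_iff {h g : HigmanGroup n} {p : polygon n} :
    h • pt g p = pt g p ↔ g⁻¹ * h * g ∈ localGroup n p := by
  rw [smul_pt, eq_comm, pt_eq_iff, mul_assoc]
  simp

/-- The translate by `g` of the `k`-th vertex of the fundamental polygon. -/
noncomputable def vtx (g : HigmanGroup n) (k : ZMod n) : vertexSet n :=
  ⟨pt g (cornerPt n k), g, k, rfl⟩

lemma exists_vtx (v : vertexSet n) : ∃ g k, v = vtx g k := by
  obtain ⟨_, g, k, rfl⟩ := v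
  exact ⟨g, k, rfl⟩

lemma vtx_mul (hn : 5 ≤ n) (g : HigmanGroup n) {k : ZMod n} {u : HigmanGroup n}
    (hu : u ∈ vgrp (gen n) k) : vtx (g * u) k = vtx g k := by
  refine Subtype.ext (pt_eq_iff.2 ⟨rfl, ?_⟩).symm
  rwa [inv_mul_cancel_left, localGroup_cornerPt hn]

lemma smul_vtx_eq_iff (hn : 5 ≤ n) {h g : HigmanGroup n} {k : ZMod n} :
    h • (vtx g k : Complex n) = vtx g k ↔ g⁻¹ * h * g ∈ vgrp (gen n) k := by
  rw [← localGroup_cornerPt hn]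
  exact smul_pt_eq_iff

lemma edist_vtx_le (g : HigmanGroup n) (k : ZMod n) :
    (oneSkeleton n).edist (vtx g k) (vtx g (k + 1)) ≤ 1 := by
  -- Equality gives distance `0`, so the two ends of an edge need not be shown to be distinct.
  by_cases h : vtx g k = vtx g (k + 1)
  · rw [h, SimpleGraph.edist_self]
    exact zero_le
  · refine (SimpleGraph.edist_eq_one_iff_adj.2 ?_).le
    rw [oneSkeleton, SimpleGraph.fromRel_adj]
    exact ⟨h, Or.inl ⟨g, k + 1, by rw [add_sub_cancel_right]; rfl, rfl⟩⟩

lemma dist_pt_le [hn : Fact (5 ≤ n)] (g : HigmanGroup n) (p q : polygon n) :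
    dist (pt g p) (pt g q) ≤ diamBound n :=
  (stringDist_le hn.out (isString_single g p q)).trans (kleinDist_le_diamBound hn.out p q)

/-- Two vertices fixed by a common nontrivial element are joined by a path of length at most two. -/
theorem exists_common_neighbour (hn : 5 ≤ n) {v v' : vertexSet n} {h : HigmanGroup n} (h1 : h ≠ 1)
    (hv : h • (v : Complex n) = v) (hv' : h • (v' : Complex n) = v') :
    ∃ (g g' : HigmanGroup n) (k l l' : ZMod n), v = vtx g k ∧ vtx g l = vtx g' l ∧ v' = vtx g' l' ∧
      (oneSkeleton n).edist (vtx g k) (vtx g l) ≤ 1 ∧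
      (oneSkeleton n).edist (vtx g' l) (vtx g' l') ≤ 1 := by
  obtain ⟨g, k, rfl⟩ := exists_vtx v
  obtain ⟨g', l, rfl⟩ := exists_vtx v'
  rw [smul_vtx_eq_iff hn] at hv hv'
  have hself : ∀ v, (oneSkeleton n).edist v v ≤ 1 := fun v => by
    rw [SimpleGraph.edist_self]; exact zero_le
  have hnear := classified_higmanGroup (by omega) k trivial l trivial _ hv
    (fun h0 => h1 (by simpa [mul_assoc, inv_mul_eq_one] using h0)) (g⁻¹ * g') trivial (by
      convert hv' using 1
      group)
  rcases hnear with ⟨rfl, h2⟩ | ⟨rfl, u, hu, w, hw, h2, -⟩ | ⟨rfl, u, hu, w, hw, h2, -⟩ |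
    ⟨rfl, j, -, rfl, u, hu, w, hw, x, hx, h2, -⟩
  · refine ⟨g, g, l, l, l, rfl, rfl, ?_, hself _, hself _⟩
    rw [← vtx_mul hn g h2, mul_inv_cancel_left]
  all_goals rw [inv_mul_eq_iff_eq_mul] at h2; subst h2
  · exact ⟨g * u, g * u, k, k + 1, k + 1, (vtx_mul hn g hu).symm, rfl,
      by rw [← mul_assoc, vtx_mul hn _ hw], edist_vtx_le _ _, hself _⟩
  · exact ⟨g * u, g * u, l + 1, l, l, (vtx_mul hn g hu).symm, rfl,
      by rw [← mul_assoc, vtx_mul hn _ hw], by rw [SimpleGraph.edist_comm]; exact edist_vtx_le _ _,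
      hself _⟩
  -- Since `w ∈ V_j`, the polygons of `g * u` and `g * u * w` share their `j`-th corner, which is
  -- the common neighbour.
  · exact ⟨g * u, g * u * w, j + 1, j, j + 1, (vtx_mul hn g hu).symm, (vtx_mul hn _ hw).symm,
      by rw [← mul_assoc, ← mul_assoc, vtx_mul hn _ hx],
      by rw [SimpleGraph.edist_comm]; exact edist_vtx_le _ _, edist_vtx_le _ _⟩

theorem stabilizer_inf_stabilizer_eq_bot (hn : 5 ≤ n) {v v' : vertexSet n}
    (hd : 3 ≤ (oneSkeleton n).edist v v') :
    MulAction.stabilizer (HigmanGroup n) (v : Complex n) ⊓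
      MulAction.stabilizer (HigmanGroup n) (v' : Complex n) = ⊥ := by
  rw [eq_bot_iff]
  rintro h ⟨hv, hv'⟩
  rw [Subgroup.mem_bot]
  by_contra h1
  obtain ⟨g, g', k, l, l', rfl, heq, rfl, e1, e2⟩ := exists_common_neighbour hn h1 hv hv'
  have h2 := (SimpleGraph.edist_triangle (v := vtx g l)).trans (add_le_add e1 (heq ▸ e2))
  exact absurd (hd.trans h2) (by norm_num)

theorem weaklyAcylindrical_complex [hn : Fact (5 ≤ n)] :
    WeaklyAcylindrical (HigmanGroup n) (Complex n) := by
  have hB : 0 ≤ diamBound n :=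
    dist_nonneg.trans (dist_pt_le 1 (cornerPt n 0) (cornerPt n 0))
  -- One diameter from each point to a fixed corner and two between the corners; the `1` makes the
  -- inequality strict. Only the identity then fixes both points.
  refine ⟨4 * diamBound n + 1, 1, by positivity, fun x y hxy => ?_⟩
  suffices {g : HigmanGroup n | g • x = x ∧ g • y = y} ⊆ {1} by
    refine (Set.encard_le_encard this).trans ?_
    simp
  rintro h ⟨hx, hy⟩
  by_contra h1
  have key : ∀ x : Complex n, h • x = x →
      ∃ v : vertexSet n, h • (v : Complex n) = v ∧ dist x v ≤ diamBound n := by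
    intro x hx
    obtain ⟨g, p, rfl⟩ := exists_pt x
    obtain ⟨k, hk⟩ := exists_localGroup_le hn.out p (smul_pt_eq_iff.1 hx)
      (fun h0 => h1 (by simpa [mul_assoc, inv_mul_eq_one] using h0))
    exact ⟨vtx g k, (smul_vtx_eq_iff hn.out).2 hk, dist_pt_le g _ _⟩
  obtain ⟨v, hv, hxv⟩ := key x hx
  obtain ⟨v', hv', hyv'⟩ := key y hy
  obtain ⟨g, g', k, l, l', rfl, heq, rfl, -, -⟩ := exists_common_neighbour hn.out h1 hv hv'
  have d1 : dist (vtx g k : Complex n) (vtx g l) ≤ diamBound n := dist_pt_le g _ _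
  have d2 : dist (vtx g l : Complex n) (vtx g' l') ≤ diamBound n := by
    rw [heq]; exact dist_pt_le g' _ _
  have t1 := dist_triangle x (vtx g k) y
  have t2 := dist_triangle (vtx g k : Complex n) (vtx g' l') y
  have t3 := dist_triangle (vtx g k : Complex n) (vtx g l) (vtx g' l')
  rw [dist_comm] at hyv'
  linarith

end Action

end Higman

theorem lemma5p1 (n : ℕ) [Fact (5 ≤ n)] :
    (∀ v v' : Higman.vertexSet n, 3 ≤ (Higman.oneSkeleton n).edist v v' →
      MulAction.stabilizer (Higman.HigmanGroup n) (v : Higman.Complex n) ⊓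
        MulAction.stabilizer (Higman.HigmanGroup n) (v' : Higman.Complex n) = ⊥) ∧
    WeaklyAcylindrical (Higman.HigmanGroup n) (Higman.Complex n) :=
  ⟨fun _ _ h => Higman.stabilizer_inf_stabilizer_eq_bot Fact.out h,
    Higman.weaklyAcylindrical_complex⟩
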